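/- Let $\mathcal A$ be a unital $C^*$-algebra and let $\tau:\mathcal A\to\mathbb C$ be a positive, faithful, tracial linear functional with $\tau(1)=1$. Let $x,s\in\mathcal A$ be free with respect to $\tau$ (that is, the unital subalgebras generated by $x$ and by $s$ are free), and let $s$ be a standard semicircular element (self-adjoint, with the moments of the semicircle law of mean $0$ and variance $1$). The free cumulants $\kappa_m(a_1,\dots,a_m)$, $m\ge1$, are defined by $\tau(a_1\cdots a_m)=\sum_{\pi\in \mathrm{NC}(m)}\prod_{V\in\pi}\kappa_{|V|}(a_i: i\in V)$ (arguments in increasing order of $i$), where $\mathrm{NC}(m)$ is the set of all non-crossing partitions of $[m]=\{1,\dots,m\}$; put $\kappa_m(a)=\kappa_m(a,\dots,a)$ and $\kappa_\rho(a)=\prod_{V\in\rho}\kappa_{|V|}(a)$ for a partition $\rho$ of $[m]$. Then for every $n\ge 1$, with $[x,s]=xs-sx$, \[ \kappa_n(x+i[x,s])=\kappa_n(x)+\sum_{k=1}^{\lfloor n/2\rfloor}\ \sum_{\substack{\sigma\in \mathrm{Int}_{\ge2}(n)\\ |\sigma|=k}}\ \sum_{\pi\in \mathrm{NC}(k)}|V_1|\,\kappa_{\pi(\sigma)}(x).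 \] Here $\mathrm{Int}_{\ge 2}(n)$ is the set of partitions $\sigma$ of $[n]$ into intervals (sets of consecutive integers) each with at least two elements, $|\sigma|$ is the number of blocks of $\sigma$, and $V_1$ is the block of $\sigma$ that contains $1$. If $\sigma=\{W_1,\dots,W_k\}$ with its blocks numbered from left to right and $\pi\in\mathrm{NC}(k)$, then $\pi(\sigma)$ is the partition of $[n]$ with the blocks $\bigcup_{j\in U}W_j$, $U\in\pi$. -/

import Mathlib

namespace FreeProb

open Finset

/-! ### Non-commutative probability -/

section Probability

variable {A : Type*} [CStarAlgebra A]

/-- `τ` is a positive, faithful, tracial linear functional on the unital C⋆-algebra `A`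
with `τ 1 = 1`. -/
structure IsFaithfulTracialState (τ : A →ₗ[ℂ] ℂ) : Prop where
  map_one : τ 1 = 1
  pos : ∀ a : A, 0 ≤ (τ (star a * a)).re ∧ (τ (star a * a)).im = 0
  faithful : ∀ a : A, τ (star a * a) = 0 → a = 0
  tracial : ∀ a b : A, τ (a * b) = τ (b * a)

/-- A family of unital subalgebras `B i` is free with respect to `τ`: the product of finitely many
(at least one) centred elements, neighbouring ones taken from different subalgebras, is centred. -/
def SubalgebrasFree {ι : Type*} (τ : A →ₗ[ℂ] ℂ) (B : ι → Subalgebra ℂ A) : Prop :=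
  ∀ (m : ℕ) (i : Fin m → ι) (a : Fin m → A), 0 < m →
    (∀ j, a j ∈ B (i j)) → (∀ j, τ (a j) = 0) →
    (∀ j k : Fin m, (k : ℕ) = (j : ℕ) + 1 → i j ≠ i k) →
    τ (List.ofFn a).prod = 0

/-- Two random variables are free if the unital subalgebras that they generate are free. -/
def AreFree (τ : A →ₗ[ℂ] ℂ) (x y : A) : Prop :=
  SubalgebrasFree τ ![Algebra.adjoin ℂ {x}, Algebra.adjoin ℂ {y}]

/-- `s` is a (standard) semicircular element: it is self-adjoint, its odd moments vanish and its
moment of order `2 m` is the `m`-th Catalan number. These are the moments of the semicircle law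
with density `√(4 - t²) / (2 π)` on `[-2, 2]`, which has mean `0` and variance `1`. -/
structure IsSemicircular (τ : A →ₗ[ℂ] ℂ) (s : A) : Prop where
  isSelfAdjoint : IsSelfAdjoint s
  odd_moment : ∀ m : ℕ, τ (s ^ (2 * m + 1)) = 0
  even_moment : ∀ m : ℕ, τ (s ^ (2 * m)) = (catalan m : ℂ)

end Probability

/-! ### Partitions of `[n]`, modelled as `Fin n` -/

/-- The partitions of the set `[n]`. -/
abbrev SetPartition (n : ℕ) : Type := Finpartition (univ : Finset (Fin n))

/-- There are no `i < j < k < l` with `i, k` in one block and `j, l` in another one. -/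
def IsNoncrossing {n : ℕ} (π : SetPartition n) : Prop :=
  ∀ V ∈ π.parts, ∀ W ∈ π.parts, ∀ i ∈ V, ∀ j ∈ W, ∀ k ∈ V, ∀ l ∈ W,
    i < j → j < k → k < l → V = W

instance {n : ℕ} : DecidablePred (IsNoncrossing (n := n)) := fun π => by
  unfold IsNoncrossing; infer_instance

/-- The set `NC(n)` of all non-crossing partitions of `[n]`. -/
def NC (n : ℕ) : Finset (SetPartition n) := {π | IsNoncrossing π}

/-- Every block is an interval, i.e. consists of consecutive numbers. -/
def IsIntervalPartition {n : ℕ} (σ : SetPartition n) : Prop :=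
  ∀ V ∈ σ.parts, ∀ i ∈ V, ∀ k ∈ V, ∀ j, i ≤ j → j ≤ k → j ∈ V

instance {n : ℕ} : DecidablePred (IsIntervalPartition (n := n)) := fun σ => by
  unfold IsIntervalPartition; infer_instance

/-- The set of interval partitions of `[n]` all of whose blocks have at least two elements. -/
def IntGeTwo (n : ℕ) : Finset (SetPartition n) :=
  {σ | IsIntervalPartition σ ∧ ∀ V ∈ σ.parts, 2 ≤ V.card}

/-- Number the blocks `W_0, …, W_{k-1}` of `σ` from left to right, that is, in the increasing order
of their least elements. Then `blockIndex σ i` is the number of the block that contains `i`. -/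
def blockIndex {n : ℕ} (σ : SetPartition n) (i : Fin n) : Fin σ.parts.card :=
  ⟨(σ.parts.filter fun V => V.min < (σ.part i).min).card, by
    refine card_lt_card (filter_ssubset.2 ⟨σ.part i, ?_, lt_irrefl _⟩)
    exact σ.part_mem.2 (mem_univ i)⟩

theorem blockIndex_surjective {n : ℕ} (σ : SetPartition n) :
    Function.Surjective (blockIndex σ) := by
  -- The rank function on the blocks is injective, hence surjective.
  have hpart : ∀ V ∈ σ.parts, ∃ i, σ.part i = V := fun V hV => by
    obtain ⟨i, hi⟩ := σ.nonempty_of_mem_parts hV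
    exact ⟨i, σ.part_eq_of_mem hV hi⟩
  have hmin : ∀ V ∈ σ.parts, ∀ W ∈ σ.parts, V.min = W.min → V = W := by
    intro V hV W hW h
    obtain ⟨a, ha⟩ := min_of_nonempty (σ.nonempty_of_mem_parts hV)
    exact σ.eq_of_mem_parts hV hW (mem_of_min ha) (mem_of_min (h ▸ ha))
  have hlt : ∀ V ∈ σ.parts, ∀ W : Finset (Fin n), V.min < W.min →
      (σ.parts.filter fun U => U.min < V.min).card
        < (σ.parts.filter fun U => U.min < W.min).card := by
    intro V hV W h
    refine card_lt_card ⟨fun U hU => ?_, fun hsub => ?_⟩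
    · rw [mem_filter] at hU ⊢
      exact ⟨hU.1, hU.2.trans h⟩
    · have := hsub (mem_filter.2 ⟨hV, h⟩)
      exact lt_irrefl _ (mem_filter.1 this).2
  let f : {V // V ∈ σ.parts} → Fin σ.parts.card := fun V =>
    ⟨(σ.parts.filter fun U => U.min < V.1.min).card,
      card_lt_card (filter_ssubset.2 ⟨V.1, V.2, lt_irrefl _⟩)⟩
  have hf : Function.Injective f := by
    intro V W h
    have h' := congrArg Fin.val h
    rcases lt_trichotomy V.1.min W.1.min with h1 | h1 | h1
    · exact absurd h' (hlt V.1 V.2 W.1 h1).ne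
    · exact Subtype.ext (hmin _ V.2 _ W.2 h1)
    · exact absurd h' (hlt W.1 W.2 V.1 h1).ne'
  have hs : Function.Surjective f :=
    ((Fintype.bijective_iff_injective_and_card f).2 ⟨hf, by simp⟩).2
  intro j
  obtain ⟨V, hV⟩ := hs j
  obtain ⟨i, hi⟩ := hpart V.1 V.2
  refine ⟨i, ?_⟩
  rw [← hV]
  simp only [blockIndex, f, hi]

/-- The partition `π(σ)` of `[n]`, for `σ = {W_0, …, W_{k-1}}` and a partition `π` of `[k]`: its
blocks are the unions `⋃_{j ∈ U} W_j` where `U` runs over the blocks of `π`. -/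
def merge {n : ℕ} (σ : SetPartition n) (π : SetPartition σ.parts.card) : SetPartition n :=
  Finpartition.ofExistsUnique
    (π.parts.image fun U => univ.filter fun i => blockIndex σ i ∈ U)
    (fun _ _ => subset_univ _)
    (by
      intro i _
      obtain ⟨U, ⟨hU, hi⟩, -⟩ := π.existsUnique_mem (mem_univ (blockIndex σ i))
      refine ⟨univ.filter fun i => blockIndex σ i ∈ U,
        ⟨mem_image_of_mem _ hU, by simpa using hi⟩, ?_⟩
      rintro T ⟨hT, hiT⟩
      obtain ⟨U', hU', rfl⟩ := mem_image.1 hT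
      rw [π.eq_of_mem_parts hU' hU (by simpa using hiT) hi])
    (by
      intro h
      obtain ⟨U, hU, hE⟩ := mem_image.1 h
      obtain ⟨j, hj⟩ := π.nonempty_of_mem_parts hU
      obtain ⟨i, hi⟩ := blockIndex_surjective σ j
      have : i ∈ (∅ : Finset (Fin n)) := hE ▸ (by simpa [hi] using hj)
      simp at this)

/-! ### Free cumulants -/

theorem card_lt_of_parts_ne {n : ℕ} {π : SetPartition n} (h : π.parts ≠ {univ})
    {V : Finset (Fin n)} (hV : V ∈ π.parts) : V.card < n := by
  have hle : V.card ≤ n := by simpa using card_le_univ V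
  refine lt_of_le_of_ne hle fun hn => h ?_
  have hVu : V = univ := (card_eq_iff_eq_univ V).1 (by simpa using hn)
  refine eq_singleton_iff_unique_mem.2 ⟨hVu ▸ hV, fun W hW => ?_⟩
  obtain ⟨i, hi⟩ := π.nonempty_of_mem_parts hW
  rw [← hVu]
  exact π.eq_of_mem_parts hW hV hi (hVu ▸ mem_univ i)

section Cumulants

variable {A : Type*} [CStarAlgebra A]

/-- The free cumulant `κ_n(a_1, …, a_n)`, determined recursively by the moment-cumulant formula
`τ(a_1 ⋯ a_n) = ∑_{π ∈ NC(n)} ∏_{V ∈ π} κ_{|V|}(a_i : i ∈ V)`, the indices in each block being taken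
in increasing order: the term of the one-block partition is `κ_n(a_1, …, a_n)`, and all the
other partitions involve cumulants of lower order only. -/
noncomputable def freeCumulant (τ : A →ₗ[ℂ] ℂ) (n : ℕ) (a : Fin n → A) : ℂ :=
  τ (List.ofFn a).prod -
    ∑ π : {π : SetPartition n // π ∈ NC n ∧ π.parts ≠ {univ}},
      ∏ V : {V : Finset (Fin n) // V ∈ π.1.parts},
        freeCumulant τ V.1.card fun j => a (V.1.orderEmbOfFin rfl j)
termination_by n
decreasing_by exact card_lt_of_parts_ne π.2.2 V.2

/-- The `n`-th free cumulant `κ_n(a) = κ_n(a, …, a)` of a random variable. -/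
noncomputable def kappa (τ : A →ₗ[ℂ] ℂ) (n : ℕ) (a : A) : ℂ :=
  freeCumulant τ n fun _ => a

/-- `κ_π(a) = ∏_{V ∈ π} κ_{|V|}(a)`. -/
noncomputable def kappaPartition (τ : A →ₗ[ℂ] ℂ) {n : ℕ} (π : SetPartition n) (a : A) : ℂ :=
  ∏ V ∈ π.parts, kappa τ V.card a

end Cumulants

end FreeProb

/-!
For free `x` and `s`, the moments of `y = x + i [x, s]` are computed in a model on the full Fock space
of words in two letters. There a variable with free cumulants `κ` is `ℓ + ∑ κ (j + 1) (ℓ*) ^ j`, where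
`ℓ` is the creation operator of one of the letters (`canonicalOp`); such operators for different
letters are free in the vacuum state (`chainProd_canonicalOp_vac`), and their moments are given by the
moment-cumulant formula (`fockCoeff_eq_ncListSum`). Since freeness determines joint moments, the
moments of `y` are those of its model (`commutator_moment`).

For a single variable with cumulant series `K(z) = ∑ κ_m z ^ m`, the vector `ξ = ∑ z ^ n ℓ ^ n Ω`
solves `(1 + K(z) - z T) ξ = Ω` and has vacuum coefficient `1`. Conversely, whenever
`(a(z) - z T) ξ = Ω` for some `ξ` with vacuum coefficient `1`, expanding the resolvent shows that
`1 = ∑ m_n z ^ n / a(z) ^ (n + 1)` for the moments `m_n` of `T`, and this determines `a`. So it is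
enough to find such a vector for the model of `y`, with the claimed cumulants as coefficients of `a`.

The vector is explicit. Annihilation of the letter of `x` acts on the pair `(ξ, η)`, where
`s ξ = c η`, by `z` times the matrix with rows `(1, i c)` and `(-i, 0)`, whose characteristic
polynomial is `t ^ 2 - t - c`; the letter of `s` is equally simple (`resolventPair`). The resolvent
equation then becomes a system of relations between power series (`resolvent_equation`). Its solution
`c` is the generating function of the sums over `σ ∈ Int_{≥2}(n)` and `π ∈ NC(|σ|)` of `κ_{π(σ)}(x)`,
the factor `1 - z t - c z ^ 2 t ^ 2` reflecting the series `∑_{n ≥ 2} z ^ n t ^ n` of the interval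
sizes; and `a` is the series obtained on weighting the summands with the size of the first interval
(`rhsSeries`).

The combinatorial input is that sums over non-crossing partitions depend only on the list of weights
of the points, and obey the recursion `ncListSum_cons` that looks for the successor of the first
point in its block. This serves both for the moment-cumulant formula and for the sums over `π`, while
the interval partitions `σ` are compositions of `n` (`sum_IntGeTwo_eq`).
-/

namespace FreeProb

open Finset

/-! ### Non-crossing partitions of finite subsets of a linear order -/

section NoncrossingSums

variable {α : Type*} [LinearOrder α]

/-- `P` is the set of blocks of a non-crossing partition of the finite set `s`. -/
structure IsNCPartition (s : Finset α) (P : Finset (Finset α)) : Prop where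
  nonempty : ∀ V ∈ P, V.Nonempty
  subset : ∀ V ∈ P, ∀ i ∈ V, i ∈ s
  cover : ∀ i ∈ s, ∃ V ∈ P, i ∈ V
  disj : ∀ V ∈ P, ∀ W ∈ P, ∀ i, i ∈ V → i ∈ W → V = W
  nc : ∀ V ∈ P, ∀ W ∈ P, ∀ i ∈ V, ∀ j ∈ W, ∀ k ∈ V, ∀ l ∈ W,
    i < j → j < k → k < l → V = W

open Classical in
/-- The non-crossing partitions of a finite subset of a linear order, as sets of blocks. -/
noncomputable def ncParts (s : Finset α) : Finset (Finset (Finset α)) :=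
  s.powerset.powerset.filter (IsNCPartition s)

theorem mem_ncParts {s : Finset α} {P : Finset (Finset α)} :
    P ∈ ncParts s ↔ IsNCPartition s P := by
  classical
  simp only [ncParts, mem_filter, mem_powerset, and_iff_right_iff_imp]
  exact fun h V hV => mem_powerset.2 fun i hi => h.subset V hV i hi

/-- The sum over all non-crossing partitions of `s` of the products of the weights `f V` of the
blocks `V`. -/
noncomputable def ncSum (f : Finset α → ℂ) (s : Finset α) : ℂ :=
  ∑ P ∈ ncParts s, ∏ V ∈ P, f V

theorem ncSum_congr {f g : Finset α → ℂ} {s : Finset α} (h : ∀ V ⊆ s, f V = g V) :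
    ncSum f s = ncSum g s :=
  sum_congr rfl fun _ hP => prod_congr rfl fun V hV => h V ((mem_ncParts.1 hP).subset V hV)

theorem ncSum_empty (f : Finset α → ℂ) : ncSum f (∅ : Finset α) = 1 := by
  have : ncParts (∅ : Finset α) = {∅} := by
    ext P
    rw [mem_ncParts, mem_singleton]
    constructor
    · intro h
      refine eq_empty_of_forall_notMem fun V hV => ?_
      obtain ⟨i, hi⟩ := h.nonempty V hV
      exact absurd (h.subset V hV i hi) (notMem_empty i)
    · rintro rfl
      constructor <;> simp
  simp [ncSum, this]

/-- The non-crossing partitions of `s` in which the least element `a` is a block of its own are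
those of `s \ {a}`, together with the block `{a}`. -/
theorem sum_ncParts_singleton_mem (f : Finset α → ℂ) {s : Finset α} {a : α} (ha : a ∈ s)
    (hmin : ∀ i ∈ s, a ≤ i) :
    ∑ P ∈ ncParts s with {a} ∈ P, ∏ V ∈ P, f V = f {a} * ncSum f (s.erase a) := by
  rw [ncSum, mul_sum]
  refine sum_nbij' (fun P => P.erase {a}) (fun P => insert {a} P) ?_ ?_ ?_ ?_ ?_
  · intro P hP
    simp only [mem_filter, mem_ncParts] at hP ⊢
    obtain ⟨hP, haP⟩ := hP
    have hd := hP.disj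
    have hs := hP.subset
    refine ⟨fun V hV => hP.nonempty V (mem_of_mem_erase hV), ?_, ?_, ?_, ?_⟩
    · intro V hV i hi
      have := hd V (mem_of_mem_erase hV) {a} haP i hi
      grind
    · intro i hi
      obtain ⟨V, hV, hiV⟩ := hP.cover i (mem_of_mem_erase hi)
      exact ⟨V, by grind, hiV⟩
    · exact fun V hV W hW => hd V (mem_of_mem_erase hV) W (mem_of_mem_erase hW)
    · exact fun V hV W hW => hP.nc V (mem_of_mem_erase hV) W (mem_of_mem_erase hW)
  · intro P hP
    simp only [mem_filter, mem_ncParts] at hP ⊢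
    have hs := hP.subset
    refine ⟨⟨?_, ?_, ?_, ?_, ?_⟩, mem_insert_self _ _⟩
    · intro V hV
      rcases mem_insert.1 hV with rfl | hV
      · exact singleton_nonempty a
      · exact hP.nonempty V hV
    · grind
    · intro i hi
      by_cases h : i = a
      · exact ⟨{a}, mem_insert_self _ _, by simp [h]⟩
      · obtain ⟨V, hV, hiV⟩ := hP.cover i (mem_erase.2 ⟨h, hi⟩)
        exact ⟨V, mem_insert_of_mem hV, hiV⟩
    · have := hP.disj
      grind
    · intro V hV W hW i hi j hj k hk l hl h1 h2 h3
      rcases mem_insert.1 hV with rfl | hV <;> rcases mem_insert.1 hW with rfl | hW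
      · rfl
      · simp only [mem_singleton] at hi hk
        subst hi; subst hk
        exact absurd (h1.trans h2) (lt_irrefl _)
      · simp only [mem_singleton] at hj hl
        subst hj; subst hl
        exact absurd (h2.trans h3) (lt_irrefl _)
      · exact hP.nc V hV W hW i hi j hj k hk l hl h1 h2 h3
  · intro P hP
    exact insert_erase (mem_filter.1 hP).2
  · intro P hP
    refine erase_insert fun h => ?_
    have := (mem_ncParts.1 hP).subset _ h a (mem_singleton_self a)
    simp at this
  · intro P hP
    exact (mul_prod_erase P f (mem_filter.1 hP).2).symm

/-- If `b` is the successor of the least element `a` in its block, then by non-crossingness every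
block is either contained in the open interval `(a, b)` or disjoint from it. The first kind of
blocks forms an arbitrary non-crossing partition of that interval; removing `a` from its block, the
second kind forms an arbitrary non-crossing partition of the elements from `b` on. -/
theorem sum_ncParts_next (f : Finset α → ℂ) {s : Finset α} {a b : α} (ha : a ∈ s)
    (hmin : ∀ i ∈ s, a ≤ i) (hb : b ∈ s) (hab : a < b) :
    ∑ P ∈ ncParts s with ∃ V ∈ P, a ∈ V ∧ b ∈ V ∧ ∀ i ∈ V, i ≤ a ∨ b ≤ i, ∏ V ∈ P, f V
      = ncSum f (s.filter fun i => a < i ∧ i < b) *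
        ncSum (fun V => if b ∈ V then f (insert a V) else f V) (s.filter (b ≤ ·)) := by
  classical
  rw [ncSum, ncSum, sum_mul_sum, ← sum_product']
  symm
  set s₁ := s.filter fun i => a < i ∧ i < b with hs₁
  set s₂ := s.filter (b ≤ ·) with hs₂
  have m1 : ∀ i, i ∈ s₁ ↔ i ∈ s ∧ a < i ∧ i < b := fun i => by simp [hs₁]
  have m2 : ∀ i, i ∈ s₂ ↔ i ∈ s ∧ b ≤ i := fun i => by simp [hs₂]
  clear_value s₁ s₂
  obtain ⟨φ, hφ0⟩ : ∃ φ : Finset α → Finset α, ∀ V, φ V = if b ∈ V then insert a V else V :=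
    ⟨_, fun _ => rfl⟩
  have hφ : ∀ V i, i ∈ φ V ↔ i ∈ V ∨ (i = a ∧ b ∈ V) := by
    intro V i
    by_cases h : b ∈ V <;> simp [hφ0, h, or_comm]
  have hφe : ∀ V, V ⊆ s₂ → (φ V).erase a = V := by
    intro V hV
    ext i
    rw [mem_erase, hφ]
    have := fun h : i ∈ V => (m2 i).1 (hV h)
    grind
  -- `φ` puts `a` back into the block of `b`.
  refine sum_nbij' (fun Q => Q.1 ∪ Q.2.image φ)
    (fun P => (P.filter (· ⊆ s₁), (P.filter (¬ · ⊆ s₁)).image fun V => V.erase a)) ?_ ?_ ?_ ?_ ?_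
  · rintro ⟨P, Q⟩ h
    simp only [mem_product, mem_filter, mem_ncParts] at h ⊢
    obtain ⟨hP, hQ⟩ := h
    have sP := hP.subset
    have sQ := hQ.subset
    obtain ⟨U, hU, hbU⟩ := hQ.cover b ((m2 b).2 ⟨hb, le_rfl⟩)
    have key : ∀ V, V ∈ P ∪ Q.image φ ↔ V ∈ P ∨ ∃ W ∈ Q, φ W = V := by simp
    have hm : ∀ W ∈ Q, ∀ i, i ∈ φ W → i = a ∧ b ∈ W ∨ i ∈ W ∧ b ≤ i ∧ i ∈ s := by
      intro W hW i hi
      rcases (hφ W i).1 hi with h | h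
      · exact Or.inr ⟨h, ((m2 i).1 (sQ W hW i h)).2, ((m2 i).1 (sQ W hW i h)).1⟩
      · exact Or.inl h
    have hm1 : ∀ W ∈ P, ∀ i ∈ W, i ∈ s ∧ a < i ∧ i < b := fun W hW i hi =>
      (m1 i).1 (sP W hW i hi)
    refine ⟨⟨?_, ?_, ?_, ?_, ?_⟩, φ U, (key _).2 (Or.inr ⟨U, hU, rfl⟩), ?_, ?_, ?_⟩
    · intro V hV
      rcases (key V).1 hV with hV | ⟨W, hW, rfl⟩
      · exact hP.nonempty V hV
      · obtain ⟨i, hi⟩ := hQ.nonempty W hW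
        exact ⟨i, (hφ W i).2 (Or.inl hi)⟩
    · intro V hV i hi
      rcases (key V).1 hV with hV | ⟨W, hW, rfl⟩
      · exact (hm1 V hV i hi).1
      · rcases hm W hW i hi with h | h
        · exact h.1 ▸ ha
        · exact h.2.2
    · intro i hi
      by_cases hia : i = a
      · exact ⟨φ U, (key _).2 (Or.inr ⟨U, hU, rfl⟩), (hφ U i).2 (Or.inr ⟨hia, hbU⟩)⟩
      · by_cases hib : i < b
        · obtain ⟨V, hV, hiV⟩ := hP.cover i
            ((m1 i).2 ⟨hi, lt_of_le_of_ne (hmin i hi) (Ne.symm hia), hib⟩)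
          exact ⟨V, (key _).2 (Or.inl hV), hiV⟩
        · obtain ⟨V, hV, hiV⟩ := hQ.cover i ((m2 i).2 ⟨hi, not_lt.1 hib⟩)
          exact ⟨φ V, (key _).2 (Or.inr ⟨V, hV, rfl⟩), (hφ V i).2 (Or.inl hiV)⟩
    · intro V hV W hW i hiV hiW
      rcases (key V).1 hV with hV | ⟨V', hV', rfl⟩ <;> rcases (key W).1 hW with hW | ⟨W', hW', rfl⟩
      · exact hP.disj V hV W hW i hiV hiW
      · have h1 := hm1 V hV i hiV
        have h2 := hm W' hW' i hiW
        grind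
      · have h1 := hm1 W hW i hiW
        have h2 := hm V' hV' i hiV
        grind
      · have h1 := hm V' hV' i hiV
        have h2 := hm W' hW' i hiW
        have h3 := hQ.disj V' hV' W' hW'
        refine congrArg φ ?_
        grind
    · intro V hV W hW i hi j hj k hk l hl h1 h2 h3
      rcases (key V).1 hV with hV | ⟨V', hV', rfl⟩ <;> rcases (key W).1 hW with hW | ⟨W', hW', rfl⟩
      · exact hP.nc V hV W hW i hi j hj k hk l hl h1 h2 h3
      · have e1 := hm1 V hV i hi
        have e2 := hm W' hW' j hj
        have e3 := hm1 V hV k hk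
        grind
      · have e1 := hm V' hV' k hk
        have e2 := hm1 W hW j hj
        have e3 := hm1 W hW l hl
        grind
      · have e1 := hm V' hV' i hi
        have e2 := hm W' hW' j hj
        have e3 := hm V' hV' k hk
        have e4 := hm W' hW' l hl
        have h4 := hQ.disj V' hV' W' hW'
        have h5 := hQ.nc V' hV' W' hW'
        refine congrArg φ ?_
        by_cases hjb : j = b
        · grind
        · rcases e1 with ⟨rfl, e1⟩ | e1
          · exact h5 b e1 j (by grind) k (by grind) l (by grind) (by grind) h2 h3
          · exact h5 i e1.1 j (by grind) k (by grind) l (by grind) h1 h2 h3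
    · exact (hφ U a).2 (Or.inr ⟨rfl, hbU⟩)
    · exact (hφ U b).2 (Or.inl hbU)
    · intro i hi
      have := hm U hU i hi
      grind
  · intro P h
    simp only [mem_filter, mem_ncParts, mem_product] at h ⊢
    obtain ⟨hP, V₀, hV₀, haV, hbV, hgap⟩ := h
    -- A block that meets `(a, b)` cannot leave it without crossing the block of `a` and `b`.
    have hsub : ∀ W ∈ P, ∀ j ∈ W, j ∈ s₁ → W ⊆ s₁ := by
      intro W hW j hj hjs l hl
      have hj' := (m1 j).1 hjs
      have hls := hP.subset W hW l hl
      have hne : V₀ ≠ W := by rintro rfl; grind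
      have hla : a < l := by
        refine lt_of_le_of_ne (hmin l hls) ?_
        rintro rfl
        exact hne (hP.disj _ hV₀ W hW _ haV hl)
      refine (m1 l).2 ⟨hls, hla, ?_⟩
      by_contra hlb
      rcases eq_or_lt_of_le (not_lt.1 hlb) with rfl | hlb
      · exact hne (hP.disj _ hV₀ W hW _ hbV hl)
      · exact hne (hP.nc V₀ hV₀ W hW a haV j hj b hbV l hl hj'.2.1 hj'.2.2 hlb)
    have hns : ∀ W ∈ P, ¬ W ⊆ s₁ → ∀ i ∈ W, i = a ∧ W = V₀ ∨ i ∈ s₂ := by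
      intro W hW hn i hi
      have h1 := hP.subset W hW i hi
      have h2 : i ∉ s₁ := fun h => hn (hsub W hW i hi h)
      have h3 := hmin i h1
      by_cases hia : i = a
      · exact Or.inl ⟨hia, hP.disj _ hW _ hV₀ i hi (hia ▸ haV)⟩
      · right
        rw [m2]
        rw [m1] at h2
        grind
    constructor
    · refine ⟨fun V hV => hP.nonempty V (mem_filter.1 hV).1,
        fun V hV i hi => (mem_filter.1 hV).2 hi, ?_, ?_, ?_⟩
      · intro i hi
        obtain ⟨V, hV, hiV⟩ := hP.cover i ((m1 i).1 hi).1
        exact ⟨V, mem_filter.2 ⟨hV, hsub V hV i hiV hi⟩, hiV⟩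
      · exact fun V hV W hW => hP.disj V (mem_filter.1 hV).1 W (mem_filter.1 hW).1
      · exact fun V hV W hW => hP.nc V (mem_filter.1 hV).1 W (mem_filter.1 hW).1
    · have key : ∀ V, V ∈ (P.filter (¬ · ⊆ s₁)).image (fun V => V.erase a) ↔
          ∃ W, (W ∈ P ∧ ¬ W ⊆ s₁) ∧ W.erase a = V := by simp
      refine ⟨?_, ?_, ?_, ?_, ?_⟩
      · intro V hV
        obtain ⟨W, ⟨hW, hn⟩, rfl⟩ := (key V).1 hV
        by_cases h : W = V₀
        · exact ⟨b, mem_erase.2 ⟨hab.ne', h ▸ hbV⟩⟩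
        · obtain ⟨i, hi⟩ := hP.nonempty W hW
          refine ⟨i, mem_erase.2 ⟨?_, hi⟩⟩
          rintro rfl
          exact h (hP.disj _ hW _ hV₀ _ hi haV)
      · intro V hV i hi
        obtain ⟨W, ⟨hW, hn⟩, rfl⟩ := (key V).1 hV
        have := hns W hW hn i (mem_of_mem_erase hi)
        have := ne_of_mem_erase hi
        tauto
      · intro i hi
        have hi' := (m2 i).1 hi
        obtain ⟨W, hW, hiW⟩ := hP.cover i hi'.1
        refine ⟨W.erase a, (key _).2 ⟨W, ⟨hW, fun h => ?_⟩, rfl⟩, mem_erase.2 ⟨?_, hiW⟩⟩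
        · exact absurd ((m1 i).1 (h hiW)).2.2 (not_lt.2 hi'.2)
        · exact (hab.trans_le hi'.2).ne'
      · intro V hV W hW i hiV hiW
        obtain ⟨V, ⟨hV', -⟩, rfl⟩ := (key V).1 hV
        obtain ⟨W, ⟨hW', -⟩, rfl⟩ := (key W).1 hW
        rw [hP.disj V hV' W hW' i (mem_of_mem_erase hiV) (mem_of_mem_erase hiW)]
      · intro V hV W hW i hi j hj k hk l hl h1 h2 h3
        obtain ⟨V, ⟨hV', -⟩, rfl⟩ := (key V).1 hV
        obtain ⟨W, ⟨hW', -⟩, rfl⟩ := (key W).1 hW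
        rw [hP.nc V hV' W hW' i (mem_of_mem_erase hi) j (mem_of_mem_erase hj) k
          (mem_of_mem_erase hk) l (mem_of_mem_erase hl) h1 h2 h3]
  · rintro ⟨P, Q⟩ h
    simp only [mem_product, mem_ncParts] at h
    obtain ⟨hP, hQ⟩ := h
    have e1 : ∀ V ∈ P, V ⊆ s₁ := fun V hV i hi => hP.subset V hV i hi
    have e2 : ∀ V ∈ Q, ¬ φ V ⊆ s₁ := by
      intro V hV h
      obtain ⟨i, hi⟩ := hQ.nonempty V hV
      have h1 := (m1 i).1 (h ((hφ V i).2 (Or.inl hi)))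
      have h2 := (m2 i).1 (hQ.subset V hV i hi)
      exact absurd h1.2.2 (not_lt.2 h2.2)
    have e3 : ∀ V ∈ Q, V ⊆ s₂ := fun V hV i hi => hQ.subset V hV i hi
    refine Prod.ext ?_ ?_
    · ext V
      simp only [mem_filter, mem_union, mem_image]
      constructor
      · rintro ⟨h | ⟨W, hW, rfl⟩, h'⟩
        · exact h
        · exact absurd h' (e2 W hW)
      · exact fun h => ⟨Or.inl h, e1 V h⟩
    · ext V
      simp only [mem_filter, mem_union, mem_image]
      constructor
      · rintro ⟨W, ⟨h | ⟨U, hU, rfl⟩, h'⟩, rfl⟩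
        · exact absurd (e1 W h) h'
        · rwa [hφe U (e3 U hU)]
      · exact fun h => ⟨φ V, ⟨Or.inr ⟨V, h, rfl⟩, e2 V h⟩, hφe V (e3 V h)⟩
  · intro P h
    simp only [mem_filter, mem_ncParts] at h
    obtain ⟨hP, V₀, hV₀, haV, hbV, hgap⟩ := h
    have hφ' : ∀ W ∈ P, φ (W.erase a) = W := by
      intro W hW
      ext i
      rw [hφ, mem_erase, mem_erase]
      have h1 := hP.disj W hW V₀ hV₀
      grind
    ext V
    simp only [mem_union, mem_filter, mem_image]
    constructor
    · rintro (h | ⟨_, ⟨W, hW, rfl⟩, rfl⟩)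
      · exact h.1
      · rw [hφ' W hW.1]; exact hW.1
    · intro h
      by_cases hV : V ⊆ s₁
      · exact Or.inl ⟨h, hV⟩
      · exact Or.inr ⟨V.erase a, ⟨V, ⟨h, hV⟩, rfl⟩, hφ' V h⟩
  · rintro ⟨P, Q⟩ h
    simp only [mem_product, mem_ncParts] at h
    obtain ⟨hP, hQ⟩ := h
    have e3 : ∀ V ∈ Q, V ⊆ s₂ := fun V hV i hi => hQ.subset V hV i hi
    rw [prod_union, prod_image]
    · congr 1
      refine prod_congr rfl fun V _ => ?_
      rw [hφ0]
      split_ifs <;> rfl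
    · intro V hV W hW h
      rw [← hφe V (e3 V hV), ← hφe W (e3 W hW), h]
    · rw [disjoint_left]
      intro V hV hV'
      obtain ⟨W, hW, rfl⟩ := mem_image.1 hV'
      obtain ⟨i, hi⟩ := hQ.nonempty W hW
      have h1 := (m1 i).1 (hP.subset _ hV i ((hφ W i).2 (Or.inl hi)))
      have h2 := (m2 i).1 (hQ.subset W hW i hi)
      exact absurd h1.2.2 (not_lt.2 h2.2)

end NoncrossingSums

/-! ### The recursion for non-crossing sums -/

/-- `ncListSum κ [m₁, …, m_k]` is the sum over `NC(k)` of the products over the blocks `U` of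
`κ (∑_{j ∈ U} m_j)`. It is defined by recursion: either the first element is a block of its own, or
its successor in its block is some later element, which then absorbs its weight, while the elements
in between are partitioned separately. -/
noncomputable def ncListSum (κ : ℕ → ℂ) : List ℕ → ℂ
  | [] => 1
  | m :: l => κ m * ncListSum κ l +
      ∑ i : Fin l.length, ncListSum κ (l.take i) * ncListSum κ ((m + l[i]) :: l.drop (i + 1))
termination_by l => l.length
decreasing_by
  · simp
  · simp
  · have := Fin.pos i
    simp
    omega

theorem ncListSum_nil (κ : ℕ → ℂ) : ncListSum κ [] = 1 := by
  rw [ncListSum]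

theorem ncListSum_cons (κ : ℕ → ℂ) (m : ℕ) (l : List ℕ) :
    ncListSum κ (m :: l) = κ m * ncListSum κ l +
      ∑ i ∈ range l.length,
        ncListSum κ (l.take i) * ncListSum κ ((m + l.getD i 0) :: l.drop (i + 1)) := by
  rw [ncListSum, ← Fin.sum_univ_eq_sum_range (fun i =>
    ncListSum κ (l.take i) * ncListSum κ ((m + l.getD i 0) :: l.drop (i + 1)))]
  congr 1
  refine sum_congr rfl fun i _ => ?_
  simp

section

variable {α : Type*} [LinearOrder α]

/-- The decomposition of non-crossing partitions according to the successor of the least element in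
its block. -/
theorem ncSum_eq_add_sum (f : Finset α → ℂ) {s : Finset α} {a : α} (ha : a ∈ s)
    (hmin : ∀ i ∈ s, a ≤ i) :
    ncSum f s = f {a} * ncSum f (s.erase a) +
      ∑ b ∈ s.erase a, ncSum f (s.filter fun i => a < i ∧ i < b) *
        ncSum (fun V => if b ∈ V then f (insert a V) else f V) (s.filter (b ≤ ·)) := by
  classical
  have hlt : ∀ b ∈ s.erase a, a < b := fun b hb =>
    lt_of_le_of_ne (hmin b (mem_of_mem_erase hb)) (ne_of_mem_erase hb).symm
  rw [← sum_ncParts_singleton_mem f ha hmin]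
  rw [sum_congr rfl fun b hb =>
    (sum_ncParts_next f ha hmin (mem_of_mem_erase hb) (hlt b hb)).symm]
  rw [ncSum, ← sum_filter_add_sum_filter_not _ (fun P => {a} ∈ P)]
  congr 1
  rw [← sum_biUnion]
  · refine sum_congr ?_ fun _ _ => rfl
    ext P
    simp only [mem_filter, mem_biUnion, mem_ncParts]
    constructor
    · rintro ⟨hP, hn⟩
      obtain ⟨V, hV, haV⟩ := hP.cover a ha
      have hne : (V.erase a).Nonempty := by
        rw [nonempty_iff_ne_empty]
        intro h
        rcases erase_eq_empty_iff V a |>.1 h with rfl | rfl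
        · simp at haV
        · exact hn hV
      have hb := min'_mem _ hne
      refine ⟨(V.erase a).min' hne, mem_erase.2 ⟨ne_of_mem_erase hb,
        hP.subset V hV _ (mem_of_mem_erase hb)⟩, hP, V, hV, haV, mem_of_mem_erase hb, ?_⟩
      intro i hi
      by_cases hia : i = a
      · exact Or.inl hia.le
      · exact Or.inr (min'_le _ _ (mem_erase.2 ⟨hia, hi⟩))
    · rintro ⟨b, hb, hP, V, hV, haV, hbV, -⟩
      refine ⟨hP, fun h => ?_⟩
      have := hP.disj _ hV _ h a haV (mem_singleton_self a)
      subst this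
      exact ne_of_mem_erase hb (mem_singleton.1 hbV)
  · intro b hb c hc hbc
    rw [Function.onFun, disjoint_left]
    intro P hPb hPc
    simp only [mem_filter, mem_ncParts] at hPb hPc
    obtain ⟨hP, V, hV, haV, hbV, h1⟩ := hPb
    obtain ⟨-, W, hW, haW, hcW, h2⟩ := hPc
    have hVW := hP.disj V hV W hW a haV haW
    subst hVW
    have e1 := h1 c hcW
    have e2 := h2 b hbV
    have e3 := hlt b hb
    have e4 := hlt c hc
    exact hbc (le_antisymm (e1.resolve_left (not_le.2 e4)) (e2.resolve_left (not_le.2 e3)))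

theorem sort_filter_lt_getElem (t : Finset α) {i : ℕ} (hi : i < (t.sort (· ≤ ·)).length) :
    (t.filter (· < (t.sort (· ≤ ·))[i])).sort (· ≤ ·) = (t.sort (· ≤ ·)).take i := by
  have hs := sortedLT_sort t
  refine List.Pairwise.eq_of_mem_iff (r := (· < ·)) (sortedLT_sort _).pairwise
    (hs.pairwise.sublist (List.take_sublist _ _)) fun x => ?_
  rw [mem_sort, mem_filter, List.mem_take_iff_getElem, ← mem_sort (· ≤ ·), List.mem_iff_getElem]
  constructor
  · rintro ⟨⟨j, hj, rfl⟩, h⟩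
    exact ⟨j, lt_min ((hs.strictMono_get.lt_iff_lt (a := ⟨j, hj⟩) (b := ⟨i, hi⟩)).1 h) hj, rfl⟩
  · rintro ⟨j, hj, rfl⟩
    have hj' := lt_min_iff.1 hj
    exact ⟨⟨j, hj'.2, rfl⟩, hs.getElem_lt_getElem_of_lt hj'.1⟩

theorem sort_filter_getElem_le (t : Finset α) {i : ℕ} (hi : i < (t.sort (· ≤ ·)).length) :
    (t.filter ((t.sort (· ≤ ·))[i] ≤ ·)).sort (· ≤ ·) = (t.sort (· ≤ ·)).drop i := by
  have hs := sortedLT_sort t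
  refine List.Pairwise.eq_of_mem_iff (r := (· < ·)) (sortedLT_sort _).pairwise
    (hs.pairwise.sublist (List.drop_sublist _ _)) fun x => ?_
  rw [mem_sort, mem_filter, List.mem_drop_iff_getElem, ← mem_sort (· ≤ ·), List.mem_iff_getElem]
  constructor
  · rintro ⟨⟨j, hj, rfl⟩, h⟩
    have := (hs.strictMono_get.le_iff_le (a := ⟨i, hi⟩) (b := ⟨j, hj⟩)).1 h
    refine ⟨j - i, ?_, ?_⟩
    · simp only [Fin.mk_le_mk] at this; omega
    · simp only [Fin.mk_le_mk] at this
      simp [Nat.add_sub_cancel' this]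
  · rintro ⟨j, hj, rfl⟩
    refine ⟨⟨i + j, by omega, rfl⟩, ?_⟩
    exact hs.strictMono_get.monotone (a := ⟨i, hi⟩) (b := ⟨i + j, by omega⟩) (by simp)

theorem sum_eq_sum_range_sort (t : Finset α) (d : α) (G : α → ℂ) :
    ∑ b ∈ t, G b = ∑ i ∈ range (t.sort (· ≤ ·)).length, G ((t.sort (· ≤ ·)).getD i d) := by
  symm
  refine sum_nbij (fun i => (t.sort (· ≤ ·)).getD i d) ?_ ?_ ?_ ?_
  · intro i hi
    rw [mem_range] at hi
    rw [List.getD_eq_getElem _ _ hi, ← mem_sort (· ≤ ·)]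
    exact List.getElem_mem hi
  · intro i hi j hj h
    simp only [coe_range, Set.mem_Iio] at hi hj
    simp only [List.getD_eq_getElem _ _ hi, List.getD_eq_getElem _ _ hj] at h
    exact (List.Nodup.getElem_inj_iff (sort_nodup t (· ≤ ·))).1 h
  · intro b hb
    obtain ⟨i, hi, h⟩ := List.mem_iff_getElem.1 ((mem_sort (· ≤ ·)).2 hb)
    exact ⟨i, by simpa using hi, by simp only [List.getD_eq_getElem _ _ hi, h]⟩
  · exact fun _ _ => rfl

/-- The sum over the non-crossing partitions of `s` of products of a function of the total weights
of the blocks depends only on the list of the weights of the elements of `s` in increasing order. -/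
theorem ncSum_weight (κ : ℕ → ℂ) (s : Finset α) (w : α → ℕ) :
    ncSum (fun V => κ (∑ i ∈ V, w i)) s = ncListSum κ ((s.sort (· ≤ ·)).map w) := by
  induction hn : s.card using Nat.strong_induction_on generalizing s w with
  | _ n ih =>
  rcases s.eq_empty_or_nonempty with rfl | hne
  · simp [ncSum_empty, ncListSum_nil]
  obtain ⟨a, ha, hmin⟩ : ∃ a ∈ s, ∀ i ∈ s, a ≤ i := ⟨_, min'_mem s hne, fun i hi => min'_le s i hi⟩
  have hlt : ∀ b ∈ s.erase a, a < b := fun b hb =>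
    lt_of_le_of_ne (hmin b (mem_of_mem_erase hb)) (ne_of_mem_erase hb).symm
  have hsort : s.sort (· ≤ ·) = a :: (s.erase a).sort (· ≤ ·) := by
    conv_lhs => rw [← insert_erase ha]
    exact sort_insert _ (fun b hb => (hlt b hb).le) (notMem_erase a s)
  rw [ncSum_eq_add_sum _ ha hmin, hsort, List.map_cons, ncListSum_cons, sum_singleton,
    ih _ (by rw [← hn]; exact card_erase_lt_of_mem ha) _ _ rfl, sum_eq_sum_range_sort _ a,
    List.length_map]
  congr 1
  refine sum_congr rfl fun i hi => ?_
  rw [mem_range] at hi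
  obtain ⟨b, hb⟩ : ∃ b, b = ((s.erase a).sort (· ≤ ·))[i] := ⟨_, rfl⟩
  have hbs : b ∈ s.erase a := by
    rw [hb, ← mem_sort (· ≤ ·)]; exact List.getElem_mem hi
  rw [List.getD_eq_getElem _ _ hi, List.getD_eq_getElem _ _ (by simpa using hi), List.getElem_map,
    ← hb, ← List.map_take, ← List.map_drop]
  have f1 : s.filter (fun i => a < i ∧ i < b) = (s.erase a).filter (· < b) := by
    ext j
    have := hmin j
    simp only [mem_filter, mem_erase]
    grind
  have f2 : s.filter (b ≤ ·) = (s.erase a).filter (b ≤ ·) := by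
    ext j
    have := hlt b hbs
    simp only [mem_filter, mem_erase]
    grind
  have c1 : ((s.erase a).filter (· < b)).card < n := by
    rw [← hn]
    exact (card_filter_le _ _).trans_lt (card_erase_lt_of_mem ha)
  have c2 : ((s.erase a).filter (b ≤ ·)).card < n := by
    rw [← hn]
    exact (card_filter_le _ _).trans_lt (card_erase_lt_of_mem ha)
  -- Inserting `a` into the block of `b` amounts to adding the weight of `a` to that of `b`.
  have hw : ncSum (fun V => if b ∈ V then κ (∑ i ∈ insert a V, w i) else κ (∑ i ∈ V, w i))
      ((s.erase a).filter (b ≤ ·)) = ncSum (fun V => κ (∑ i ∈ V,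
        Function.update w b (w a + w b) i)) ((s.erase a).filter (b ≤ ·)) := by
    refine ncSum_congr fun V hV => ?_
    split_ifs with h
    · have haV : a ∉ V := fun h => by simpa using hV h
      rw [sum_insert haV, sum_update_of_mem h, ← sum_sdiff (singleton_subset_iff.2 h),
        sum_singleton]
      congr 1
      ring
    · rw [sum_update_of_notMem h]
  rw [f1, f2, hw, ih _ c1 _ _ rfl, ih _ c2 _ _ rfl]
  have e1 := sort_filter_lt_getElem (s.erase a) hi
  have e2 := sort_filter_getElem_le (s.erase a) hi
  rw [← hb] at e1 e2
  rw [e1, e2, List.drop_eq_getElem_cons hi, List.map_cons, ← hb, Function.update_self]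
  congr 3
  refine List.map_congr_left fun x hx => ?_
  rw [Function.update_of_ne]
  rintro rfl
  have hnd := (sort_nodup (s.erase a) (· ≤ ·)).sublist (List.drop_sublist i _)
  rw [List.drop_eq_getElem_cons hi, ← hb, List.nodup_cons] at hnd
  exact hnd.1 hx

end

/-- Sums over `NC n` are sums over `ncParts univ`, a `Finpartition` being determined by its parts. -/
theorem sum_NC_prod {n : ℕ} (f : Finset (Fin n) → ℂ) :
    ∑ π ∈ NC n, ∏ V ∈ π.parts, f V = ncSum f univ := by
  refine sum_bij (fun π _ => π.parts) ?_ ?_ ?_ ?_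
  · intro π hπ
    rw [mem_ncParts]
    refine ⟨fun V hV => π.nonempty_of_mem_parts hV, fun _ _ i _ => mem_univ i, fun i hi => ?_,
      fun V hV W hW i hi hj => π.eq_of_mem_parts hV hW hi hj, (mem_filter.1 hπ).2⟩
    obtain ⟨V, hV, -⟩ := π.existsUnique_mem hi
    exact ⟨V, hV⟩
  · exact fun π _ ρ _ h => Finpartition.ext h
  · intro P hP
    rw [mem_ncParts] at hP
    refine ⟨Finpartition.ofExistsUnique P (fun _ _ => subset_univ _) ?_ ?_,
      mem_filter.2 ⟨mem_univ _, hP.nc⟩, rfl⟩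
    · intro i hi
      obtain ⟨V, hV, hiV⟩ := hP.cover i hi
      exact ⟨V, ⟨hV, hiV⟩, fun W hW => hP.disj W hW.1 V hV i hW.2 hiV⟩
    · exact fun h => by simpa using hP.nonempty _ h
  · exact fun _ _ => rfl

theorem sum_NC_weight (κ : ℕ → ℂ) {n : ℕ} (w : Fin n → ℕ) :
    ∑ π ∈ NC n, ∏ V ∈ π.parts, κ (∑ i ∈ V, w i) = ncListSum κ (List.ofFn w) := by
  rw [sum_NC_prod (fun V => κ (∑ i ∈ V, w i)), ncSum_weight, Fin.sort_univ, List.ofFn_eq_map]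

section Moments

variable {A : Type*} [CStarAlgebra A]

theorem kappa_eq (τ : A →ₗ[ℂ] ℂ) (n : ℕ) (a : A) :
    kappa τ n a = τ (a ^ n) -
      ∑ π ∈ NC n with π.parts ≠ {univ}, ∏ V ∈ π.parts, kappa τ V.card a := by
  rw [kappa, freeCumulant, List.ofFn_const, List.prod_replicate]
  congr 1
  rw [sum_subtype (p := fun π => π ∈ NC n ∧ π.parts ≠ {univ}) _ (fun π => mem_filter)]
  exact sum_congr rfl fun π _ => prod_coe_sort π.1.parts fun V => kappa τ V.card a

/-- The moment-cumulant formula. -/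
theorem map_pow_eq_sum_NC {τ : A →ₗ[ℂ] ℂ} (hτ : IsFaithfulTracialState τ) (n : ℕ) (a : A) :
    τ (a ^ n) = ∑ π ∈ NC n, ∏ V ∈ π.parts, kappa τ V.card a := by
  classical
  rcases Nat.eq_zero_or_pos n with rfl | hn
  -- For `n = 0` the only partition has no blocks; in particular it is not `{univ}`.
  · rw [sum_NC_prod (fun V => kappa τ V.card a), univ_eq_empty, ncSum_empty, pow_zero, hτ.map_one]
  rw [← sum_filter_add_sum_filter_not (NC n) (fun π => π.parts ≠ {univ})]
  have h := kappa_eq τ n a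
  have : ∑ π ∈ NC n with ¬ π.parts ≠ {univ}, ∏ V ∈ π.parts, kappa τ V.card a = kappa τ n a := by
    have hne : (univ : Finset (Fin n)) ≠ ⊥ := by
      have : Nonempty (Fin n) := ⟨⟨0, hn⟩⟩
      exact univ_nonempty.ne_empty
    rw [sum_eq_single (Finpartition.indiscrete hne)]
    · simp
    · intro π hπ h
      simp only [mem_filter, not_not] at hπ
      exact absurd (Finpartition.ext (hπ.2.trans (by simp))) h
    · intro h
      refine absurd (mem_filter.2 ⟨mem_filter.2 ⟨mem_univ _, ?_⟩, by simp⟩) h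
      intro V hV W hW
      simp only [Finpartition.indiscrete_parts, mem_singleton] at hV hW
      simp [hV, hW]
  rw [this, h]
  ring

theorem map_pow_eq_ncListSum {τ : A →ₗ[ℂ] ℂ} (hτ : IsFaithfulTracialState τ) (n : ℕ) (a : A) :
    τ (a ^ n) = ncListSum (fun m => kappa τ m a) (List.replicate n 1) := by
  rw [map_pow_eq_sum_NC hτ, ← List.ofFn_const, ← sum_NC_weight]
  simp

end Moments

/-! ### Interval partitions and their block sizes -/

section

variable {n : ℕ} (σ : SetPartition n)

theorem blockIndex_lt_of_min_lt {i j : Fin n} (h : (σ.part i).min < (σ.part j).min) :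
    blockIndex σ i < blockIndex σ j := by
  refine Fin.mk_lt_mk.2 (card_lt_card ⟨fun U hU => ?_, fun hsub => ?_⟩)
  · rw [mem_filter] at hU ⊢
    exact ⟨hU.1, hU.2.trans h⟩
  · have := hsub (mem_filter.2 ⟨σ.part_mem.2 (mem_univ i), h⟩)
    exact lt_irrefl _ (mem_filter.1 this).2

theorem blockIndex_eq_iff {i j : Fin n} :
    blockIndex σ i = blockIndex σ j ↔ σ.part i = σ.part j := by
  constructor
  · intro h
    rcases lt_trichotomy (σ.part i).min (σ.part j).min with h1 | h1 | h1
    · exact absurd h (blockIndex_lt_of_min_lt σ h1).ne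
    · have hi := σ.part_mem.2 (mem_univ i)
      have hj := σ.part_mem.2 (mem_univ j)
      obtain ⟨a, ha⟩ := min_of_nonempty (σ.nonempty_of_mem_parts hi)
      exact σ.eq_of_mem_parts hi hj (mem_of_min ha) (mem_of_min (h1 ▸ ha))
    · exact absurd h (blockIndex_lt_of_min_lt σ h1).ne'
  · intro h
    simp only [blockIndex, h]

theorem filter_blockIndex_eq (i : Fin n) :
    univ.filter (fun j => blockIndex σ j = blockIndex σ i) = σ.part i := by
  ext j
  rw [mem_filter, blockIndex_eq_iff, and_iff_right (mem_univ j)]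
  constructor
  · intro h
    rw [← h]
    exact σ.mem_part (mem_univ j)
  · exact fun h => σ.part_eq_of_mem (σ.part_mem.2 (mem_univ i)) h

theorem blockIndex_monotone (hσ : IsIntervalPartition σ) : Monotone (blockIndex σ) := by
  intro i j hij
  by_contra hlt
  rw [not_le] at hlt
  have hi := σ.part_mem.2 (mem_univ i)
  have hj := σ.part_mem.2 (mem_univ j)
  have hne : σ.part i ≠ σ.part j := fun h => hlt.ne' ((blockIndex_eq_iff σ).2 h)
  have hmin : (σ.part j).min < (σ.part i).min := by
    rcases lt_trichotomy (σ.part i).min (σ.part j).min with h1 | h1 | h1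
    · exact absurd (blockIndex_lt_of_min_lt σ h1) hlt.not_gt
    · obtain ⟨a, ha⟩ := min_of_nonempty (σ.nonempty_of_mem_parts hi)
      exact absurd (σ.eq_of_mem_parts hi hj (mem_of_min ha) (mem_of_min (h1 ▸ ha))) hne
    · exact h1
  obtain ⟨a, ha⟩ := min_of_nonempty (σ.nonempty_of_mem_parts hj)
  have hai : a ≤ i := by
    have h2 : (σ.part i).min ≤ i := min_le (σ.mem_part (mem_univ i))
    rw [ha] at hmin
    exact WithTop.coe_le_coe.1 (hmin.le.trans h2)
  have := hσ _ hj a (mem_of_min ha) j (σ.mem_part (mem_univ j)) i hai hij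
  exact hne (σ.eq_of_mem_parts hi hj (σ.mem_part (mem_univ i)) this)

/-- The list of the cardinalities of the blocks, in the order in which `blockIndex` numbers them. -/
def blockSizes : List ℕ :=
  List.ofFn fun k => (univ.filter fun i => blockIndex σ i = k).card

theorem length_blockSizes : (blockSizes σ).length = σ.parts.card := by
  simp [blockSizes]

theorem sum_blockSizes : (blockSizes σ).sum = n := by
  rw [blockSizes, List.sum_ofFn, ← card_eq_sum_card_fiberwise (fun _ _ => mem_univ _), card_univ,
    Fintype.card_fin]

theorem two_le_of_mem_blockSizes (hσ : ∀ V ∈ σ.parts, 2 ≤ V.card) :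
    ∀ m ∈ blockSizes σ, 2 ≤ m := by
  intro m hm
  obtain ⟨k, rfl⟩ := List.mem_ofFn.1 hm
  obtain ⟨i, rfl⟩ := blockIndex_surjective σ k
  rw [filter_blockIndex_eq]
  exact hσ _ (σ.part_mem.2 (mem_univ i))

theorem headI_blockSizes (hσ : IsIntervalPartition σ) (hn : 0 < n) :
    (blockSizes σ).headI = (σ.part ⟨0, hn⟩).card := by
  have h0 : (blockIndex σ ⟨0, hn⟩ : ℕ) = 0 := by
    have hpos : 0 < σ.parts.card := card_pos.2 ⟨_, σ.part_mem.2 (mem_univ ⟨0, hn⟩)⟩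
    obtain ⟨i, hi⟩ := blockIndex_surjective σ ⟨0, hpos⟩
    have : blockIndex σ ⟨0, hn⟩ ≤ blockIndex σ i := blockIndex_monotone σ hσ (Nat.zero_le _)
    rw [hi] at this
    exact Nat.le_zero.1 this
  have hlt : 0 < (blockSizes σ).length := by
    rw [length_blockSizes, ← h0]
    exact (blockIndex σ ⟨0, hn⟩).2
  have : (blockSizes σ).headI = (blockSizes σ)[0] := by
    rw [← List.head_eq_getElem (List.ne_nil_of_length_pos hlt)]
    generalize blockSizes σ = l at hlt ⊢
    cases l with
    | nil => simp at hlt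
    | cons a l => simp
  rw [this, ← filter_blockIndex_eq]
  simp only [blockSizes, List.getElem_ofFn]
  congr 2
  ext i
  rw [← Fin.val_inj, ← Fin.val_inj, h0]

/-- For an interval partition, the elements of the first `t` blocks form an initial segment, whose
length is the sum of the first `t` block sizes. So the partition can be recovered from the sizes. -/
theorem blockIndex_lt_iff (hσ : IsIntervalPartition σ) (i : Fin n) (t : ℕ) :
    (blockIndex σ i : ℕ) < t ↔ (i : ℕ) < ((blockSizes σ).take t).sum := by
  have hcard : (univ.filter fun i : Fin n => (blockIndex σ i : ℕ) < t).card
      = ((blockSizes σ).take t).sum := by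
    have h1 : ((blockSizes σ).take t).sum = ∑ k ∈ univ.filter fun k : Fin σ.parts.card => (k : ℕ) < t,
        (univ.filter fun i => blockIndex σ i = k).card := by
      rw [blockSizes, List.sum_take_ofFn]
    have h2 := @card_eq_sum_card_fiberwise (Fin n) (Fin σ.parts.card) _ (blockIndex σ)
      (univ.filter fun i => (blockIndex σ i : ℕ) < t)
      (univ.filter fun k => (k : ℕ) < t) fun j hj => by simpa using hj
    rw [h1, h2]
    · refine sum_congr rfl fun k hk => ?_
      congr 1
      ext j
      simp only [mem_filter, mem_univ, true_and] at hk ⊢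
      constructor
      · exact fun h => h.2
      · rintro rfl
        exact ⟨hk, rfl⟩
  rw [← hcard]
  constructor
  · intro h
    have hsub : Finset.Iic i ⊆ univ.filter fun i => (blockIndex σ i : ℕ) < t := by
      intro j hj
      rw [mem_Iic] at hj
      rw [mem_filter]
      exact ⟨mem_univ j, lt_of_le_of_lt (blockIndex_monotone σ hσ hj) h⟩
    have := card_le_card hsub
    rw [Fin.card_Iic] at this
    omega
  · intro h
    by_contra hge
    have hsub : (univ.filter fun i => (blockIndex σ i : ℕ) < t) ⊆ Finset.Iio i := by
      intro j hj
      rw [mem_Iio]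
      by_contra hij
      rw [not_lt] at hij hge
      have h1 := (mem_filter.1 hj).2
      have h2 : (blockIndex σ i : ℕ) ≤ blockIndex σ j := blockIndex_monotone σ hσ hij
      omega
    have := card_le_card hsub
    rw [Fin.card_Iio] at this
    omega

end

theorem eq_of_blockSizes_eq {n : ℕ} {σ ρ : SetPartition n} (hσ : IsIntervalPartition σ)
    (hρ : IsIntervalPartition ρ) (h : blockSizes σ = blockSizes ρ) : σ = ρ := by
  have key : ∀ i, (blockIndex σ i : ℕ) = blockIndex ρ i := fun i => eq_of_forall_gt_iff fun t => by
    rw [blockIndex_lt_iff σ hσ, blockIndex_lt_iff ρ hρ, h]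
  have hpart : ∀ i, σ.part i = ρ.part i := by
    intro i
    rw [← filter_blockIndex_eq, ← filter_blockIndex_eq]
    ext j
    simp only [mem_filter, ← Fin.val_inj, key]
  have hsub : ∀ σ ρ : SetPartition n, (∀ i, σ.part i = ρ.part i) → σ.parts ⊆ ρ.parts := by
    intro σ ρ h V hV
    obtain ⟨i, hi⟩ := σ.nonempty_of_mem_parts hV
    rw [← σ.part_eq_of_mem hV hi, h]
    exact ρ.part_mem.2 (mem_univ i)
  exact Finpartition.ext (Subset.antisymm (hsub σ ρ hpart) (hsub ρ σ fun i => (hpart i).symm))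

/-- A monotone map from `Fin n` onto an initial segment of `ℕ` is determined by its fibres. -/
theorem eq_of_monotone_of_fibres {n : ℕ} {f g : Fin n → ℕ} (hf : Monotone f) (hg : Monotone g)
    (hf' : ∀ i, ∀ t < f i, ∃ j, f j = t) (hg' : ∀ i, ∀ t < g i, ∃ j, g j = t)
    (h : ∀ i j, f i = f j ↔ g i = g j) (i : Fin n) : f i = g i := by
  have key : ∀ {f g : Fin n → ℕ}, Monotone g → (∀ i, ∀ t < g i, ∃ j, g j = t) →
      (∀ i j, f i = f j → g i = g j) → ∀ i, (∀ j < i, f j = g j) → ¬ f i < g i := by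
    intro f g hg hg' h i ih hlt
    obtain ⟨j, hj⟩ := hg' i _ hlt
    have hji : j < i := by
      by_contra hji
      have := hg (not_lt.1 hji)
      omega
    have := h j i ((ih j hji).trans hj)
    omega
  induction i using WellFoundedLT.induction with
  | ind i ih =>
    refine le_antisymm (not_lt.1 ?_) (not_lt.1 ?_)
    · exact key hf hf' (fun i j => (h i j).2) i fun j hj => (ih j hj).symm
    · exact key hg hg' (fun i j => (h i j).1) i ih

/-! ### Interval partitions as compositions -/

/-- The compositions of `n` all of whose parts are at least two, as lists. -/
def compGeTwo (n : ℕ) : Finset (List ℕ) :=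
  ((univ : Finset (Composition n)).image Composition.blocks).filter fun l => ∀ m ∈ l, 2 ≤ m

theorem mem_compGeTwo {n : ℕ} {l : List ℕ} :
    l ∈ compGeTwo n ↔ l.sum = n ∧ ∀ m ∈ l, 2 ≤ m := by
  rw [compGeTwo, mem_filter, mem_image]
  constructor
  · rintro ⟨⟨c, -, rfl⟩, h⟩
    exact ⟨c.blocks_sum, h⟩
  · rintro ⟨h1, h2⟩
    exact ⟨⟨⟨l, fun hi => Nat.zero_lt_two.trans_le (h2 _ hi), h1⟩, mem_univ _, rfl⟩, h2⟩

theorem composition_index_monotone {n : ℕ} (c : Composition n) : Monotone c.index := by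
  intro i j hij
  by_contra h
  rw [not_le] at h
  have h1 := c.lt_sizeUpTo_index_succ j
  have h2 := c.sizeUpTo_index_le i
  have h3 : c.sizeUpTo (c.index j).succ ≤ c.sizeUpTo (c.index i) := c.monotone_sizeUpTo h
  have h4 : (i : ℕ) ≤ j := hij
  omega

theorem composition_index_surjective {n : ℕ} (c : Composition n) :
    Function.Surjective c.index := fun k =>
  ⟨c.embedding k ⟨0, c.one_le_blocksFun k⟩, c.index_embedding k _⟩

theorem card_filter_composition_index_eq {n : ℕ} (c : Composition n) (k : Fin c.length) :
    (univ.filter fun i => c.index i = k).card = c.blocksFun k := by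
  have : univ.filter (fun i => c.index i = k) = univ.map (c.embedding k).toEmbedding := by
    ext i
    have h := c.mem_range_embedding_iff' (j := i) (i := k)
    simp only [mem_filter, mem_univ, true_and, mem_map]
    rw [eq_comm, ← h]
    simp
  rw [this, card_map, card_univ, Fintype.card_fin]

/-- Every composition into parts at least two is the list of block sizes of an interval partition:
the one given by the fibres of `Composition.index`. -/
theorem exists_blockSizes_eq {n : ℕ} {l : List ℕ} (hl : l ∈ compGeTwo n) :
    ∃ σ ∈ IntGeTwo n, blockSizes σ = l := by
  classical
  obtain ⟨hl, h2⟩ := mem_filter.1 hl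
  obtain ⟨c, -, rfl⟩ := mem_image.1 hl
  let σ : SetPartition n := Finpartition.ofSetoid (Setoid.ker c.index)
  have hpart : ∀ i j, j ∈ σ.part i ↔ c.index i = c.index j := fun i j =>
    Finpartition.mem_part_ofSetoid_iff_rel
  have hex : ∀ V ∈ σ.parts, ∃ i, V = σ.part i := by
    intro V hV
    obtain ⟨i, hi⟩ := σ.nonempty_of_mem_parts hV
    exact ⟨i, (σ.part_eq_of_mem hV hi).symm⟩
  have hint : IsIntervalPartition σ := by
    intro V hV i hi k hk j hij hjk
    obtain ⟨a, rfl⟩ := hex V hV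
    rw [hpart] at hi hk ⊢
    have h1 := composition_index_monotone c hij
    have h2 := composition_index_monotone c hjk
    exact le_antisymm (hi ▸ h1) (hk ▸ h2)
  have hidx : ∀ i, (blockIndex σ i : ℕ) = c.index i := by
    refine eq_of_monotone_of_fibres (blockIndex_monotone σ hint) (composition_index_monotone c)
      ?_ ?_ ?_
    · intro i t ht
      obtain ⟨j, hj⟩ := blockIndex_surjective σ ⟨t, ht.trans (blockIndex σ i).2⟩
      exact ⟨j, by rw [hj]⟩
    · intro i t ht
      obtain ⟨j, hj⟩ := composition_index_surjective c ⟨t, ht.trans (c.index i).2⟩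
      exact ⟨j, by rw [hj]⟩
    · intro i j
      rw [Fin.val_inj, Fin.val_inj, blockIndex_eq_iff, ← hpart, ←
        σ.mem_part_iff_part_eq_part (mem_univ i) (mem_univ j), hpart, hpart, eq_comm]
  have hlen : σ.parts.card = c.length := by
    refine eq_of_forall_lt_iff fun t => ⟨fun ht => ?_, fun ht => ?_⟩
    · obtain ⟨j, hj⟩ := blockIndex_surjective σ ⟨t, ht⟩
      have := hidx j
      rw [hj] at this
      exact lt_of_eq_of_lt this (c.index j).2
    · obtain ⟨j, hj⟩ := composition_index_surjective c ⟨t, ht⟩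
      have := hidx j
      rw [hj] at this
      exact lt_of_eq_of_lt this.symm (blockIndex σ j).2
  have hsizes : blockSizes σ = c.blocks := by
    refine List.ext_getElem (by rw [length_blockSizes, hlen]) fun k h1 h2 => ?_
    have hk : k < c.length := h2
    have := card_filter_composition_index_eq c ⟨k, hk⟩
    rw [Composition.blocksFun] at this
    simp only [List.get_eq_getElem] at this
    rw [← this]
    simp only [blockSizes, List.getElem_ofFn]
    congr 1
    ext i
    simp only [mem_filter, ← Fin.val_inj, hidx]
  refine ⟨σ, mem_filter.2 ⟨mem_univ _, hint, fun V hV => ?_⟩, hsizes⟩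
  obtain ⟨i, rfl⟩ := hex V hV
  refine h2 _ ?_
  rw [← filter_blockIndex_eq, ← hsizes, blockSizes]
  exact List.mem_ofFn.2 ⟨_, rfl⟩

/-- A block of `π(σ)` is a union of blocks `W_k` of `σ`, so its size is the sum of their sizes. -/
theorem kappaPartition_merge {A : Type*} [CStarAlgebra A] (τ : A →ₗ[ℂ] ℂ) (x : A) {n : ℕ}
    (σ : SetPartition n) (π : SetPartition σ.parts.card) :
    kappaPartition τ (merge σ π) x = ∏ U ∈ π.parts,
      kappa τ (∑ k ∈ U, (univ.filter fun i => blockIndex σ i = k).card) x := by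
  change ∏ V ∈ π.parts.image (fun U => univ.filter fun i => blockIndex σ i ∈ U),
    kappa τ V.card x = _
  rw [prod_image]
  · refine prod_congr rfl fun U _ => ?_
    congr 1
    rw [card_eq_sum_card_fiberwise (f := blockIndex σ) (t := U) fun i hi => by simpa using hi]
    refine sum_congr rfl fun k hk => ?_
    congr 1
    ext i
    simp only [mem_filter, mem_univ, true_and, and_iff_right_iff_imp]
    rintro rfl
    exact hk
  · intro U _ W _ h
    ext k
    obtain ⟨i, rfl⟩ := blockIndex_surjective σ k
    simpa using congrArg (i ∈ ·) h

/-- The sum over interval partitions and non-crossing partitions, as a sum over compositions. -/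
theorem sum_IntGeTwo_eq {A : Type*} [CStarAlgebra A] (τ : A →ₗ[ℂ] ℂ) (x : A) {n : ℕ}
    (hn : 1 ≤ n) :
    ∑ k ∈ Icc 1 (n / 2), ∑ σ ∈ (IntGeTwo n).filter (fun σ => σ.parts.card = k),
      ∑ π ∈ NC σ.parts.card, ((σ.part ⟨0, hn⟩).card : ℂ) * kappaPartition τ (merge σ π) x
    = ∑ l ∈ compGeTwo n, (l.headI : ℂ) * ncListSum (fun m => kappa τ m x) l := by
  rw [sum_fiberwise_of_maps_to]
  · refine sum_bij (fun σ _ => blockSizes σ) ?_ ?_ ?_ ?_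
    · intro σ hσ
      exact mem_compGeTwo.2 ⟨sum_blockSizes σ,
        two_le_of_mem_blockSizes σ (mem_filter.1 hσ).2.2⟩
    · exact fun σ hσ ρ hρ h =>
        eq_of_blockSizes_eq (mem_filter.1 hσ).2.1 (mem_filter.1 hρ).2.1 h
    · intro l hl
      obtain ⟨σ, hσ, h⟩ := exists_blockSizes_eq hl
      exact ⟨σ, hσ, h⟩
    · intro σ hσ
      rw [← mul_sum, headI_blockSizes σ (mem_filter.1 hσ).2.1 hn, blockSizes, ← sum_NC_weight]
      simp only [kappaPartition_merge]
  · intro σ hσ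
    rw [mem_Icc, Nat.le_div_iff_mul_le Nat.zero_lt_two]
    refine ⟨card_pos.2 ⟨_, σ.part_mem.2 (mem_univ ⟨0, hn⟩)⟩, ?_⟩
    have h := σ.sum_card_parts
    rw [card_univ, Fintype.card_fin] at h
    calc σ.parts.card * 2 = ∑ V ∈ σ.parts, 2 := by simp
      _ ≤ ∑ V ∈ σ.parts, V.card := sum_le_sum (mem_filter.1 hσ).2.2
      _ = n := h

/-! ### Generating functions of sums over compositions -/

/-- `ncListSum κ l` involves only the cumulants of order at most the sum of `l`. -/
theorem ncListSum_congr {κ κ' : ℕ → ℂ} (l : List ℕ) (h : ∀ m ≤ l.sum, κ m = κ' m) :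
    ncListSum κ l = ncListSum κ' l := by
  induction hn : l.length using Nat.strong_induction_on generalizing l with
  | _ n ih =>
  cases l with
  | nil => rw [ncListSum_nil, ncListSum_nil]
  | cons m l =>
    simp only [List.sum_cons, List.length_cons] at h hn
    rw [ncListSum_cons, ncListSum_cons, h m (by omega),
      ih _ (by omega) l (fun k hk => h k (by omega)) rfl]
    congr 1
    refine sum_congr rfl fun i hi => ?_
    rw [mem_range] at hi
    have hsum : (l.take i).sum + (l[i] + (l.drop (i + 1)).sum) = l.sum := by
      rw [← List.sum_cons, ← List.drop_eq_getElem_cons hi, List.sum_take_add_sum_drop]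
    rw [List.getD_eq_getElem _ _ hi,
      ih _ (by rw [← hn]; simp) (l.take i) (fun k hk => h k (by omega)) rfl,
      ih _ (by rw [← hn]; simp; omega) ((m + l[i]) :: l.drop (i + 1))
        (fun k hk => h k (by rw [List.sum_cons] at hk; omega)) rfl]

theorem ncListSum_cons_eq_zero {κ : ℕ → ℂ} {N : ℕ} (h : ∀ m, N < m → κ m = 0) {m : ℕ} (hm : N < m)
    (l : List ℕ) : ncListSum κ (m :: l) = 0 := by
  induction hn : l.length using Nat.strong_induction_on generalizing l m with
  | _ n ih =>
  rw [ncListSum_cons, h m hm, zero_mul, zero_add]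
  refine sum_eq_zero fun i hi => ?_
  rw [mem_range] at hi
  rw [ih _ (by rw [← hn]; simp; omega) (by omega) _ rfl, mul_zero]

theorem compGeTwo_zero : compGeTwo 0 = {[]} := by
  ext l
  rw [mem_compGeTwo, mem_singleton]
  constructor
  · rintro ⟨h1, h2⟩
    cases l with
    | nil => rfl
    | cons a l =>
      have := h2 a List.mem_cons_self
      rw [List.sum_cons] at h1
      omega
  · rintro rfl
    simp

/-- Summing over compositions by their first part. -/
theorem sum_compGeTwo_succ (F : List ℕ → ℂ) {n : ℕ} (hn : n ≠ 0) :
    ∑ l ∈ compGeTwo n, F l = ∑ p ∈ antidiagonal n,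
      if 2 ≤ p.1 then ∑ l ∈ compGeTwo p.2, F (p.1 :: l) else 0 := by
  rw [← sum_filter, sum_sigma']
  symm
  refine sum_bij' (fun b _ => b.1.1 :: b.2) (fun l _ => ⟨(l.headI, l.tail.sum), l.tail⟩)
    ?_ ?_ ?_ ?_ ?_
  · rintro ⟨⟨j, k⟩, l⟩ h
    simp only [mem_sigma, mem_filter, HasAntidiagonal.mem_antidiagonal, mem_compGeTwo] at h ⊢
    simp only [List.sum_cons, List.mem_cons, forall_eq_or_imp]
    obtain ⟨⟨h1, h2⟩, h3, h4⟩ := h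
    exact ⟨by omega, h2, h4⟩
  · intro l h
    rw [mem_compGeTwo] at h
    cases l with
    | nil => exact absurd h.1.symm (by simpa using hn)
    | cons a l =>
      simp only [List.sum_cons, List.mem_cons, forall_eq_or_imp] at h
      simp only [List.headI_cons, List.tail_cons, mem_sigma, mem_filter, HasAntidiagonal.mem_antidiagonal,
        mem_compGeTwo]
      exact ⟨⟨h.1, h.2.1⟩, trivial, h.2.2⟩
  · rintro ⟨⟨j, k⟩, l⟩ h
    simp only [mem_sigma, mem_compGeTwo] at h
    simp [h.2.1]
  · intro l h
    rw [mem_compGeTwo] at h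
    cases l with
    | nil => exact absurd h.1.symm (by simpa using hn)
    | cons a l => rfl
  · exact fun _ _ => rfl

/-- Summing over compositions with a marked part. -/
theorem sum_compGeTwo_split (F : List ℕ → ℂ) (G : ℕ → List ℕ → ℂ) (n : ℕ) :
    ∑ l ∈ compGeTwo n, ∑ i ∈ range l.length,
        F (l.take i) * G (l.getD i 0) (l.drop (i + 1))
      = ∑ p ∈ antidiagonal n, (∑ l ∈ compGeTwo p.1, F l) *
          ∑ q ∈ antidiagonal p.2, if 2 ≤ q.1 then ∑ l ∈ compGeTwo q.2, G q.1 l else 0 := by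
  simp_rw [← sum_filter, sum_mul_sum, mul_sum, sum_sigma']
  refine sum_bij'
    (fun a _ => ⟨((a.1.take a.2).sum, (a.1.drop a.2).sum), a.1.take a.2,
      (a.1.getD a.2 0, (a.1.drop (a.2 + 1)).sum), a.1.drop (a.2 + 1)⟩)
    (fun b _ => ⟨b.2.1 ++ b.2.2.1.1 :: b.2.2.2, b.2.1.length⟩) ?_ ?_ ?_ ?_ ?_
  · rintro ⟨l, i⟩ h
    simp only [mem_sigma, mem_range, mem_compGeTwo] at h
    obtain ⟨⟨h1, h2⟩, h3⟩ := h
    simp only [mem_sigma, mem_filter, HasAntidiagonal.mem_antidiagonal, mem_compGeTwo,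
      List.getD_eq_getElem _ _ h3]
    refine ⟨?_, ⟨trivial, fun m hm => h2 m (List.mem_of_mem_take hm)⟩, ⟨?_,
      h2 _ (List.getElem_mem h3)⟩, trivial, fun m hm => h2 m (List.mem_of_mem_drop hm)⟩
    · rw [List.sum_take_add_sum_drop, h1]
    · rw [List.drop_eq_getElem_cons h3, List.sum_cons]
  · rintro ⟨⟨p, q⟩, l₁, ⟨j, k⟩, l₂⟩ h
    simp only [mem_sigma, mem_filter, HasAntidiagonal.mem_antidiagonal, mem_compGeTwo] at h
    obtain ⟨h1, ⟨h2, h3⟩, ⟨h4, h5⟩, h6, h7⟩ := h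
    simp only [mem_sigma, mem_compGeTwo, mem_range, List.sum_append, List.sum_cons,
      List.length_append, List.length_cons, List.mem_append, List.mem_cons]
    refine ⟨⟨by omega, ?_⟩, by omega⟩
    rintro m (hm | rfl | hm)
    · exact h3 m hm
    · exact h5
    · exact h7 m hm
  · rintro ⟨l, i⟩ h
    simp only [mem_sigma, mem_range] at h
    have h3 := h.2
    simp only [List.getD_eq_getElem _ _ h3, ← List.drop_eq_getElem_cons h3, List.take_append_drop,
      List.length_take, min_eq_left h3.le]
  · rintro ⟨⟨p, q⟩, l₁, ⟨j, k⟩, l₂⟩ h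
    simp only [mem_sigma, mem_filter, HasAntidiagonal.mem_antidiagonal, mem_compGeTwo] at h
    obtain ⟨h1, ⟨h2, h3⟩, ⟨h4, h5⟩, h6, h7⟩ := h
    have e : (l₁ ++ j :: l₂).drop (l₁.length + 1) = l₂ := by
      rw [← List.drop_drop, List.drop_left]; rfl
    simp [e, h2, h6, h4]
  · exact fun _ _ => rfl

section GeneratingFunctions

open PowerSeries

/-- The sum of `ncListSum κ (m :: l)` over all compositions `l` of `n` into parts at least two. -/
noncomputable def compSum (κ : ℕ → ℂ) (m n : ℕ) : ℂ :=
  ∑ l ∈ compGeTwo n, ncListSum κ (m :: l)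

/-- The generating function of the sums of `ncListSum κ l` over the compositions `l` of `n` into
parts at least two. -/
noncomputable def compSeries (κ : ℕ → ℂ) : ℂ⟦X⟧ :=
  mk fun n => ∑ l ∈ compGeTwo n, ncListSum κ l

/-- The generating function of `compSum κ m`. -/
noncomputable def headSeries (κ : ℕ → ℂ) (m : ℕ) : ℂ⟦X⟧ :=
  mk (compSum κ m)

/-- The series `∑_{j ≥ 2} z ^ j * headSeries κ (m + j)`, given by its coefficients. -/
noncomputable def tailSeries (κ : ℕ → ℂ) (m : ℕ) : ℂ⟦X⟧ :=
  mk fun n => ∑ p ∈ antidiagonal n, if 2 ≤ p.1 then compSum κ (m + p.1) p.2 else 0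

/-- The series `∑_{j ≥ 0} κ (m + j) * z ^ j + ∑_{j ≥ 2} (j - 1) * z ^ j * headSeries κ (m + j)`,
given by its coefficients. Here `p.1 - 1` is the truncated difference, which vanishes for `p.1 ≤ 1`. -/
noncomputable def weightSeries (κ : ℕ → ℂ) (m : ℕ) : ℂ⟦X⟧ :=
  mk fun n => κ (m + n) +
    ∑ p ∈ antidiagonal n, ((p.1 - 1 : ℕ) : ℂ) * compSum κ (m + p.1) p.2

variable (κ : ℕ → ℂ)

/-- Splitting off the first part of a composition. -/
theorem compSeries_eq : compSeries κ = 1 + tailSeries κ 0 := by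
  ext n
  rcases eq_or_ne n 0 with rfl | hn
  · simp [compSeries, tailSeries, compGeTwo_zero, ncListSum_nil]
  · rw [compSeries, coeff_mk, sum_compGeTwo_succ _ hn, map_add, coeff_one, if_neg hn, zero_add,
      tailSeries, coeff_mk]
    simp only [zero_add, compSum]

/-- The recursion `ncListSum_cons`: the parts between the first element and its successor in its
block contribute the factor `compSeries κ`. -/
theorem headSeries_eq (m : ℕ) :
    headSeries κ m = compSeries κ * (C (κ m) + tailSeries κ m) := by
  ext n
  rw [mul_add, map_add, coeff_mul_C, coeff_mul, headSeries, coeff_mk, compSum]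
  rw [sum_congr rfl fun l _ => ncListSum_cons κ m l, sum_add_distrib]
  rw [sum_compGeTwo_split (ncListSum κ) (fun j l => ncListSum κ ((m + j) :: l)), ← mul_sum]
  simp only [compSeries, tailSeries, coeff_mk, compSum, mul_comm]

theorem tailSeries_eq (m : ℕ) :
    tailSeries κ m = X ^ 2 * headSeries κ (m + 2) + X * tailSeries κ (m + 1) := by
  ext n
  rcases n with - | n
  · simp [tailSeries]
  rw [map_add, coeff_succ_X_mul, pow_two, mul_assoc, coeff_succ_X_mul, tailSeries, coeff_mk,
    Nat.sum_antidiagonal_succ]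
  rcases n with - | n
  · simp [tailSeries]
  rw [coeff_succ_X_mul, tailSeries, coeff_mk, Nat.sum_antidiagonal_succ,
    Nat.sum_antidiagonal_succ]
  rcases n with - | n
  · simp [headSeries]
  rw [Nat.sum_antidiagonal_succ, Nat.sum_antidiagonal_succ]
  simp [headSeries, add_assoc, add_comm 1]

theorem weightSeries_eq (m : ℕ) :
    weightSeries κ m = C (κ m) + tailSeries κ m + X * weightSeries κ (m + 1) := by
  ext n
  rcases n with - | n
  · simp [weightSeries, tailSeries]
  rw [map_add, map_add, coeff_succ_X_mul, weightSeries, coeff_mk, weightSeries, coeff_mk,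
    tailSeries, coeff_mk, Nat.sum_antidiagonal_succ, Nat.sum_antidiagonal_succ, coeff_C]
  have : ∀ p : ℕ × ℕ, ((p.1 + 1 - 1 : ℕ) : ℂ) * compSum κ (m + (p.1 + 1)) p.2
      = (if 2 ≤ p.1 + 1 then compSum κ (m + (p.1 + 1)) p.2 else 0)
        + ((p.1 - 1 : ℕ) : ℂ) * compSum κ (m + 1 + p.1) p.2 := by
    intro p
    have e : m + 1 + p.1 = m + (p.1 + 1) := by ring
    rw [e]
    rcases hp : p.1 with - | k
    · simp
    · simp
      ring
  rw [sum_congr rfl fun p _ => this p, sum_add_distrib]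
  have e : m + 1 + n = m + (n + 1) := by ring
  simp [e]
  ring

theorem compSum_eq_zero {N : ℕ} (h : ∀ m, N < m → κ m = 0) {m n : ℕ} (hm : N < m) :
    compSum κ m n = 0 :=
  sum_eq_zero fun l _ => ncListSum_cons_eq_zero h hm l

theorem weightSeries_eq_zero {N : ℕ} (h : ∀ m, N < m → κ m = 0) {m : ℕ} (hm : N < m) :
    weightSeries κ m = 0 := by
  ext n
  rw [weightSeries, coeff_mk, map_zero, h _ (by omega), zero_add]
  refine sum_eq_zero fun p _ => ?_
  rw [compSum_eq_zero κ h (by omega), mul_zero]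

/-- If only finitely many cumulants are nonzero, then `tailSeries` and `weightSeries` satisfy the same
linear recursion, which determines them. -/
theorem tailSeries_eq_mul_weightSeries {N : ℕ} (h : ∀ m, N < m → κ m = 0) (m : ℕ) :
    tailSeries κ m = X ^ 2 * compSeries κ * weightSeries κ (m + 2) := by
  have ht : ∀ m, N < m → tailSeries κ m = 0 := by
    intro m hm
    ext n
    rw [tailSeries, coeff_mk, map_zero]
    refine sum_eq_zero fun p _ => ?_
    rw [compSum_eq_zero κ h (by omega), ite_self]
  -- The difference of the two sides for `m` is `z` times that for `m + 1`, and it vanishes for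
  -- `m > N`.
  suffices ∀ d m, N < m + d →
      tailSeries κ m = X ^ 2 * compSeries κ * weightSeries κ (m + 2) from
    this (N + 1) m (by omega)
  intro d
  induction d with
  | zero =>
    intro m hm
    rw [ht m hm, weightSeries_eq_zero κ h (by omega), mul_zero]
  | succ d ih =>
    intro m hm
    have h1 := tailSeries_eq κ m
    have h2 := ih (m + 1) (by omega)
    have h3 := weightSeries_eq κ (m + 2)
    have h4 := headSeries_eq κ (m + 2)
    rw [h4] at h1
    linear_combination h1 + X * h2 - X ^ 2 * compSeries κ * h3

/-- The series with constant coefficient `1` whose coefficients of positive order are the claimed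
free cumulants of `x + i [x, s]`, if `κ` are those of `x`; see `coeff_rhsSeries`. -/
noncomputable def rhsSeries : ℂ⟦X⟧ :=
  1 + 2 * tailSeries κ 0 + X * weightSeries κ 1

theorem coeff_rhsSeries {n : ℕ} (hn : n ≠ 0) :
    coeff n (rhsSeries κ) = κ n + ∑ l ∈ compGeTwo n, (l.headI : ℂ) * ncListSum κ l := by
  have h := weightSeries_eq κ 0
  have : rhsSeries κ = 1 + tailSeries κ 0 + weightSeries κ 0 - C (κ 0) := by
    rw [rhsSeries]
    linear_combination -h
  rw [this, map_sub, map_add, map_add, coeff_one, coeff_C, if_neg hn, if_neg hn,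
    sum_compGeTwo_succ _ hn, tailSeries, weightSeries, coeff_mk, coeff_mk]
  have : ∀ p : ℕ × ℕ, (if 2 ≤ p.1 then ∑ l ∈ compGeTwo p.2,
      ((p.1 :: l).headI : ℂ) * ncListSum κ (p.1 :: l) else 0)
      = (if 2 ≤ p.1 then compSum κ (0 + p.1) p.2 else 0)
        + ((p.1 - 1 : ℕ) : ℂ) * compSum κ (0 + p.1) p.2 := by
    intro p
    simp only [List.headI_cons, ← mul_sum, zero_add]
    rw [← compSum]
    split_ifs with h
    · rw [Nat.cast_sub (by omega)]
      push_cast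
      ring
    · have : p.1 - 1 = 0 := by omega
      simp [this]
  rw [sum_congr rfl fun p _ => this p, sum_add_distrib]
  simp
  ring

end GeneratingFunctions

open PowerSeries

/-! ### Moments of canonical operators -/

/-- The vector `T ^ n Ω` for the operator `T = ℓ + ∑_{j < N} κ (j + 1) (ℓ*) ^ j` on the full Fock
space of a one-dimensional space: `fockCoeff κ N n j` is its component of degree `j`. -/
noncomputable def fockCoeff (κ : ℕ → ℂ) (N : ℕ) : ℕ → ℕ → ℂ
  | 0, j => if j = 0 then 1 else 0
  | n + 1, j => (if j = 0 then 0 else fockCoeff κ N n (j - 1)) +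
      ∑ i ∈ range N, κ (i + 1) * fockCoeff κ N n (i + j)

section

variable (κ : ℕ → ℂ) (N : ℕ)

theorem fockCoeff_zero_zero : fockCoeff κ N 0 0 = 1 := by simp [fockCoeff]

theorem fockCoeff_zero_succ (j : ℕ) : fockCoeff κ N 0 (j + 1) = 0 := by simp [fockCoeff]

theorem fockCoeff_succ_zero (n : ℕ) :
    fockCoeff κ N (n + 1) 0 = ∑ i ∈ range N, κ (i + 1) * fockCoeff κ N n i := by
  simp [fockCoeff]

theorem fockCoeff_succ_succ (n j : ℕ) : fockCoeff κ N (n + 1) (j + 1) =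
    fockCoeff κ N n j + ∑ i ∈ range N, κ (i + 1) * fockCoeff κ N n (i + j + 1) := by
  simp [fockCoeff, add_assoc]

/-- `fockCoeff κ N n j` counts weighted lattice paths of length `n` from height `0` to height `j`
with up-steps of size one; this is their decomposition at the last visit to height `0`. -/
theorem fockCoeff_succ_succ_eq_sum (n j : ℕ) : fockCoeff κ N (n + 1) (j + 1) =
    ∑ p ∈ antidiagonal n, fockCoeff κ N p.1 0 * fockCoeff κ N p.2 j := by
  induction n generalizing j with
  | zero => simp [fockCoeff_succ_succ, fockCoeff_zero_succ, fockCoeff_zero_zero]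
  | succ n ih =>
    rw [fockCoeff_succ_succ, Nat.sum_antidiagonal_succ']
    simp_rw [ih]
    rcases j with - | j
    · rw [fockCoeff_zero_zero, mul_one]
      simp_rw [fockCoeff_succ_zero κ N, mul_sum, add_zero]
      rw [sum_comm]
      simp_rw [← mul_sum, mul_left_comm]
      simp [mul_sum]
    · rw [fockCoeff_zero_succ, mul_zero, zero_add, ih]
      simp_rw [fockCoeff_succ_succ κ N, mul_add, sum_add_distrib, mul_sum]
      congr 1
      rw [sum_comm]
      simp_rw [mul_left_comm, add_assoc]

/-- The vacuum moments of the operator `ℓ + ∑ κ (j + 1) (ℓ*) ^ j` are the moments with free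
cumulants `κ`. -/
theorem fockCoeff_eq_ncListSum (hκ : ∀ m, N < m → κ m = 0) (n : ℕ) :
    fockCoeff κ N n 0 = ncListSum κ (List.replicate n 1) := by
  have step : ∀ m, 1 ≤ m → ∀ n, ∑ i ∈ range N, κ (m + i) * fockCoeff κ N n i =
      κ m * fockCoeff κ N n 0 + ∑ i ∈ range N, κ (m + 1 + i) * fockCoeff κ N n (i + 1) := by
    intro m hm n
    have h : κ (m + N) = 0 := hκ _ (by omega)
    calc _ = ∑ i ∈ range (N + 1), κ (m + i) * fockCoeff κ N n i := by
          rw [sum_range_succ, h, zero_mul, add_zero]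
      _ = _ := by
          rw [sum_range_succ', add_zero, add_comm]
          congr 1
          refine sum_congr rfl fun i _ => ?_
          rw [show m + (i + 1) = m + 1 + i by ring]
  have hrep : ∀ m n, ncListSum κ (m :: List.replicate (n + 1) 1) =
      κ m * ncListSum κ (List.replicate (n + 1) 1) + ∑ p ∈ antidiagonal n,
        ncListSum κ (List.replicate p.1 1) * ncListSum κ ((m + 1) :: List.replicate p.2 1) := by
    intro m n
    rw [ncListSum_cons, Nat.sum_antidiagonal_eq_sum_range_succ (fun a b =>
      ncListSum κ (List.replicate a 1) * ncListSum κ ((m + 1) :: List.replicate b 1)),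
      List.length_replicate]
    congr 1
    refine sum_congr rfl fun i hi => ?_
    rw [mem_range] at hi
    rw [List.getD_eq_getElem _ _ (by simpa using hi), List.getElem_replicate, List.take_replicate,
      List.drop_replicate, min_eq_left hi.le, Nat.succ_sub_succ]
  -- The sums `∑ i, κ (m + i) * fockCoeff κ N n i` obey the recursion `ncListSum_cons`.
  suffices ∀ n, fockCoeff κ N n 0 = ncListSum κ (List.replicate n 1) ∧ ∀ m, 1 ≤ m →
      ∑ i ∈ range N, κ (m + i) * fockCoeff κ N n i = ncListSum κ (m :: List.replicate n 1) from
    (this n).1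
  intro n
  induction n using Nat.strong_induction_on with
  | _ n ih =>
  rcases n with - | n
  · refine ⟨by rw [fockCoeff_zero_zero, List.replicate_zero, ncListSum_nil], fun m hm => ?_⟩
    rw [step m hm, ncListSum_cons]
    simp [fockCoeff_zero_succ, fockCoeff_zero_zero, ncListSum_nil]
  · have h0 : fockCoeff κ N (n + 1) 0 = ncListSum κ (List.replicate (n + 1) 1) := by
      rw [fockCoeff_succ_zero, List.replicate_succ, ← (ih n (by omega)).2 1 le_rfl]
      simp_rw [add_comm 1]
    refine ⟨h0, fun m hm => ?_⟩
    rw [step m hm, hrep, ← h0]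
    congr 1
    simp_rw [fockCoeff_succ_succ_eq_sum, mul_sum]
    rw [sum_comm]
    refine sum_congr rfl fun p hp => ?_
    rw [HasAntidiagonal.mem_antidiagonal] at hp
    rw [← (ih p.1 (by omega)).1, ← (ih p.2 (by omega)).2 (m + 1) (by omega), mul_sum]
    exact sum_congr rfl fun i _ => by ring

end

/-- The free cumulants of a standard semicircular element. -/
noncomputable def semicircularCumulant (m : ℕ) : ℂ := if m = 2 then 1 else 0

theorem fockCoeff_semicircular_succ {N : ℕ} (hN : 2 ≤ N) (n : ℕ) :
    fockCoeff semicircularCumulant N (n + 1) 0 = fockCoeff semicircularCumulant N n 1 := by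
  rw [fockCoeff_succ_zero, sum_eq_single 1]
  · simp [semicircularCumulant]
  · intro i _ hi
    rw [semicircularCumulant, if_neg (by omega), zero_mul]
  · intro h
    exact absurd (mem_range.2 hN) h

/-- The moments of the operator `ℓ + ℓ*` are those of the semicircle law. -/
theorem fockCoeff_semicircular {N : ℕ} (hN : 2 ≤ N) (m : ℕ) :
    fockCoeff semicircularCumulant N (2 * m) 0 = catalan m ∧
      fockCoeff semicircularCumulant N (2 * m + 1) 0 = 0 := by
  induction m using Nat.strong_induction_on with
  | _ m ih =>
  have step : ∀ n, fockCoeff semicircularCumulant N (n + 2) 0 = ∑ p ∈ antidiagonal n,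
      fockCoeff semicircularCumulant N p.1 0 * fockCoeff semicircularCumulant N p.2 0 := fun n => by
    rw [fockCoeff_semicircular_succ hN, fockCoeff_succ_succ_eq_sum]
  rcases m with - | m
  · rw [mul_zero, zero_add, fockCoeff_semicircular_succ hN, fockCoeff_zero_zero,
      fockCoeff_zero_succ]
    simp
  constructor
  · rw [show 2 * (m + 1) = 2 * m + 2 by ring, step, catalan_succ', Nat.cast_sum]
    symm
    refine sum_of_injOn (fun p => (2 * p.1, 2 * p.2)) ?_ ?_ ?_ ?_
    · rintro ⟨a, b⟩ - ⟨c, d⟩ - h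
      simp only [Prod.mk.injEq] at h ⊢
      omega
    · rintro ⟨a, b⟩ h
      simp only [mem_coe, HasAntidiagonal.mem_antidiagonal] at h ⊢
      omega
    · rintro ⟨a, b⟩ h h'
      rw [HasAntidiagonal.mem_antidiagonal] at h
      simp only at h ⊢
      rcases Nat.even_or_odd' a with ⟨c, rfl | rfl⟩
      · refine absurd ⟨(c, m - c), ?_, ?_⟩ h'
        · simp only [mem_coe, HasAntidiagonal.mem_antidiagonal]
          omega
        · simp only [Prod.mk.injEq, true_and]
          omega
      · rw [(ih c (by omega)).2, zero_mul]
    · rintro ⟨a, b⟩ h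
      rw [HasAntidiagonal.mem_antidiagonal] at h
      simp only at h ⊢
      rw [(ih a (by omega)).1, (ih b (by omega)).1, Nat.cast_mul]
  · rw [show 2 * (m + 1) + 1 = 2 * m + 1 + 2 by ring, step]
    refine sum_eq_zero ?_
    rintro ⟨a, b⟩ h
    rw [HasAntidiagonal.mem_antidiagonal] at h
    simp only at h ⊢
    rcases Nat.even_or_odd' a with ⟨c, rfl | rfl⟩
    · obtain ⟨d, rfl⟩ : ∃ d, b = 2 * d + 1 := ⟨m - c, by omega⟩
      rw [(ih d (by omega)).2, mul_zero]
    · rw [(ih c (by omega)).2, zero_mul]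

/-! ### The Fock space model of two free variables -/

/-- The space of all formal sums of words in two letters with coefficients in `ℂ⟦X⟧`: a completion
of the full Fock space of a two-dimensional space. The letter `true` belongs to `x`, the letter
`false` to `s`. -/
abbrev Fock : Type := List Bool → ℂ⟦X⟧

/-- The vacuum vector. -/
noncomputable def vac : Fock := fun w => if w = [] then 1 else 0

/-- The creation operator, which puts the letter `b` in front of a word. -/
noncomputable def cre (b : Bool) : Module.End ℂ⟦X⟧ Fock where
  toFun F w := match w with
    | [] => 0
    | a :: w => if a = b then F w else 0
  map_add' F G := by
    ext1 w
    rcases w with - | ⟨a, w⟩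
    · simp
    · by_cases h : a = b <;> simp [h]
  map_smul' c F := by
    ext1 w
    rcases w with - | ⟨a, w⟩
    · simp
    · by_cases h : a = b <;> simp [h]

/-- The annihilation operator, which removes the letter `b` in front of a word. -/
noncomputable def ann (b : Bool) : Module.End ℂ⟦X⟧ Fock where
  toFun F w := F (b :: w)
  map_add' _ _ := rfl
  map_smul' _ _ := rfl

/-- The operator `ℓ + ∑_{j < N} κ (j + 1) (ℓ*) ^ j`, where `ℓ` is the creation operator of the
letter `b`. If `κ` vanishes beyond `N`, then its free cumulants in the vacuum state are `κ`. -/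
noncomputable def canonicalOp (κ : ℕ → ℂ) (N : ℕ) (b : Bool) : Module.End ℂ⟦X⟧ Fock :=
  cre b + ∑ j ∈ range N, C (κ (j + 1)) • ann b ^ j

theorem cre_nil (b : Bool) (F : Fock) : cre b F [] = 0 := rfl

theorem cre_cons (a b : Bool) (F : Fock) (w : List Bool) :
    cre b F (a :: w) = if a = b then F w else 0 := rfl

theorem ann_apply (b : Bool) (F : Fock) (w : List Bool) : ann b F w = F (b :: w) := rfl

theorem ann_pow_apply (b : Bool) (j : ℕ) (F : Fock) (w : List Bool) :
    (ann b ^ j) F w = F (List.replicate j b ++ w) := by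
  induction j generalizing F with
  | zero => rfl
  | succ j ih =>
    rw [pow_succ, Module.End.mul_apply, ih, ann_apply, List.replicate_succ, List.cons_append]

theorem canonicalOp_apply (κ : ℕ → ℂ) (N : ℕ) (b : Bool) (F : Fock) (w : List Bool) :
    canonicalOp κ N b F w =
      cre b F w + ∑ j ∈ range N, C (κ (j + 1)) * F (List.replicate j b ++ w) := by
  simp [canonicalOp, LinearMap.sum_apply, ann_pow_apply]

/-- The operator with letter `b` acts only on the leading letters `b` of a word. -/
theorem canonicalOp_pow_apply (κ : ℕ → ℂ) (N : ℕ) {b : Bool} {F : Fock}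
    (hF : ∀ w, F (b :: w) = 0) {w : List Bool} (hw : w.head? ≠ some b) (n j : ℕ) :
    (canonicalOp κ N b ^ n) F (List.replicate j b ++ w) = C (fockCoeff κ N n j) * F w := by
  induction n generalizing j with
  | zero =>
    rcases j with - | j
    · simp [fockCoeff_zero_zero]
    · simp [fockCoeff_zero_succ, List.replicate_succ, hF]
  | succ n ih =>
    rw [pow_succ', Module.End.mul_apply, canonicalOp_apply]
    have h1 : ∀ i, (canonicalOp κ N b ^ n) F (List.replicate i b ++ (List.replicate j b ++ w))
        = C (fockCoeff κ N n (i + j)) * F w := by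
      intro i
      rw [← List.append_assoc, ← List.replicate_add, ih]
    have h2 : cre b ((canonicalOp κ N b ^ n) F) (List.replicate j b ++ w)
        = C (if j = 0 then 0 else fockCoeff κ N n (j - 1)) * F w := by
      rcases j with - | j
      · rcases w with - | ⟨a, w⟩
        · simp [cre_nil]
        · have : a ≠ b := by simpa using hw
          simp [cre_cons, this]
      · simp [List.replicate_succ, cre_cons, ih]
    rw [h2, fockCoeff, map_add, add_mul, map_sum, sum_mul]
    simp_rw [h1, map_mul, mul_assoc]

theorem aeval_canonicalOp_apply (κ : ℕ → ℂ) (N : ℕ) {b : Bool} {F : Fock}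
    (hF : ∀ w, F (b :: w) = 0) {w : List Bool} (hw : w.head? ≠ some b) (f : Polynomial ℂ) :
    Polynomial.aeval (canonicalOp κ N b) f F w =
      C (f.sum fun n c => c * fockCoeff κ N n 0) * F w := by
  have h : ∀ n, (canonicalOp κ N b ^ n) F w = C (fockCoeff κ N n 0) * F w := fun n =>
    canonicalOp_pow_apply κ N hF hw n 0
  rw [Polynomial.aeval_eq_sum_range, Polynomial.sum_over_range _ (by simp)]
  simp [LinearMap.sum_apply, h, map_sum, sum_mul, PowerSeries.smul_eq_C_mul, mul_assoc]

section Matching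

variable {A : Type*} [CStarAlgebra A]

/-- For a product `f₁(a_{b₁}) f₂(a_{b₂}) ⋯`, given by the list of the pairs `(b_i, f_i)`, the total
degree of the polynomials in the variable with index `true`. -/
def chainDegree (L : List (Bool × Polynomial ℂ)) : ℕ :=
  (L.map fun p => if p.1 then p.2.natDegree else 0).sum

/-- The list `L` of pairs `(b, f)` stands for a product of polynomials `f (a b)` which are centred and
in which neighbouring factors have different variables. -/
structure IsCentredChain (τ : A →ₗ[ℂ] ℂ) (a : Bool → A) (L : List (Bool × Polynomial ℂ)) :
    Prop where
  alternating : L.IsChain fun p q => p.1 ≠ q.1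
  centred : ∀ p ∈ L, τ (Polynomial.aeval (a p.1) p.2) = 0

/-- The product of the values of a list of polynomials at the given variables. -/
noncomputable def chainProd {B : Type*} [Ring B] [Algebra ℂ B] (a : Bool → B)
    (L : List (Bool × Polynomial ℂ)) : B :=
  (L.map fun p => Polynomial.aeval (a p.1) p.2).prod

theorem map_chainProd_eq_zero {τ : A →ₗ[ℂ] ℂ} {x s : A} (h : AreFree τ x s)
    {L : List (Bool × Polynomial ℂ)} (hL : IsCentredChain τ (fun b => if b then x else s) L)
    (hne : L ≠ []) : τ (chainProd (fun b => if b then x else s) L) = 0 := by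
  have key := h L.length (fun j => if (L.get j).1 then 0 else 1)
    (fun j => Polynomial.aeval (if (L.get j).1 then x else s) (L.get j).2)
    (List.length_pos_of_ne_nil hne) ?_ ?_ ?_
  · rw [← key, chainProd]
    congr 2
    exact List.ext_getElem (by simp) (by intros; simp)
  · intro j
    cases (L.get j).1
    · exact Polynomial.aeval_mem_adjoin_singleton ℂ s
    · exact Polynomial.aeval_mem_adjoin_singleton ℂ x
  · exact fun j => hL.centred _ (L.get_mem j)
  · intro j k hjk
    have := List.isChain_iff_getElem.1 hL.alternating j (by rw [← hjk]; exact k.2)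
    have e : L.get k = L[(j : ℕ) + 1]'(by rw [← hjk]; exact k.2) := by
      simp only [List.get_eq_getElem, hjk]
    simp only [e]
    simp only [List.get_eq_getElem]
    revert this
    cases (L[(j : ℕ)]).1 <;> cases (L[(j : ℕ) + 1]'(by rw [← hjk]; exact k.2)).1 <;> simp

theorem chainProd_cons {B : Type*} [Ring B] [Algebra ℂ B] (a : Bool → B)
    (p : Bool × Polynomial ℂ) (L : List (Bool × Polynomial ℂ)) :
    chainProd a (p :: L) = Polynomial.aeval (a p.1) p.2 * chainProd a L := by
  rw [chainProd, chainProd, List.map_cons, List.prod_cons]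

theorem chainProd_prod {B D : Type*} [Ring B] [Algebra ℂ B] [Ring D] [Algebra ℂ D] (a : Bool → B)
    (d : Bool → D) (L : List (Bool × Polynomial ℂ)) :
    chainProd (fun b => (a b, d b)) L = (chainProd a L, chainProd d L) := by
  induction L with
  | nil => rfl
  | cons p L ih =>
    rw [chainProd_cons, chainProd_cons, chainProd_cons, ih, Polynomial.aeval_prod_apply]
    rfl

/-- The span of the products in the variables `d b` of the chains which are centred for `a` and have
`chainDegree` at most `M`. It is used with `d b = (a b, T b)` in a product algebra, so as to compare
the joint moments of the `a b` with those of operators `T b`. -/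
noncomputable def chainSpan (τ : A →ₗ[ℂ] ℂ) (a : Bool → A) {B : Type*} [Ring B] [Algebra ℂ B]
    (d : Bool → B) (M : ℕ) : Submodule ℂ B :=
  Submodule.span ℂ {u | ∃ L, IsCentredChain τ a L ∧ chainDegree L ≤ M ∧ u = chainProd d L}

section Span

variable {τ : A →ₗ[ℂ] ℂ} {a : Bool → A} {B : Type*} [Ring B] [Algebra ℂ B] {d : Bool → B}

theorem chainSpan_mono {M M' : ℕ} (h : M ≤ M') : chainSpan τ a d M ≤ chainSpan τ a d M' :=
  Submodule.span_mono fun _ ⟨L, h1, h2, h3⟩ => ⟨L, h1, h2.trans h, h3⟩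

theorem one_mem_chainSpan (M : ℕ) : (1 : B) ∈ chainSpan τ a d M :=
  Submodule.subset_span ⟨[], ⟨List.IsChain.nil, by simp⟩, by simp [chainDegree], by simp [chainProd]⟩

/-- Centring the new factor `f` leaves a chain that begins with it and a multiple of the old one. -/
theorem aeval_mul_chainProd_mem (hτ : τ 1 = 1) {M : ℕ} {b : Bool} (f : Polynomial ℂ)
    {L : List (Bool × Polynomial ℂ)} (hL : IsCentredChain τ a L)
    (hb : ∀ p ∈ L.head?, b ≠ p.1)
    (hM : (if b then f.natDegree else 0) + chainDegree L ≤ M) :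
    Polynomial.aeval (d b) f * chainProd d L ∈ chainSpan τ a d M := by
  set c := τ (Polynomial.aeval (a b) f) with hc
  have h1 : Polynomial.aeval (d b) f * chainProd d L =
      chainProd d ((b, f - Polynomial.C c) :: L) + c • chainProd d L := by
    rw [chainProd_cons]
    simp only [map_sub, Polynomial.aeval_C, sub_mul, Algebra.algebraMap_eq_smul_one, smul_mul_assoc,
      one_mul, sub_add_cancel]
  rw [h1]
  refine Submodule.add_mem _ (Submodule.subset_span ⟨_, ⟨?_, ?_⟩, ?_, rfl⟩)
    (Submodule.smul_mem _ _ (Submodule.subset_span ⟨L, hL, by omega, rfl⟩))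
  · exact List.isChain_cons.2 ⟨hb, hL.alternating⟩
  · intro p hp
    rcases List.mem_cons.1 hp with rfl | hp
    · simp [Algebra.algebraMap_eq_smul_one, hτ, hc]
    · exact hL.centred p hp
  · rw [chainDegree, List.map_cons, List.sum_cons]
    simpa [chainDegree] using hM

/-- If the chain begins with the same variable, multiplication by it changes the first polynomial `f`
into `X * f`, and otherwise it adds a factor. -/
theorem mul_mem_chainSpan (hτ : τ 1 = 1) {M : ℕ} (b : Bool) {u : B}
    (hu : u ∈ chainSpan τ a d M) : d b * u ∈ chainSpan τ a d (M + if b then 1 else 0) := by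
  suffices chainSpan τ a d M ≤
      (chainSpan τ a d (M + if b then 1 else 0)).comap (LinearMap.mulLeft ℂ (d b)) from this hu
  refine Submodule.span_le.2 ?_
  rintro _ ⟨L, hL, hM, rfl⟩
  change d b * chainProd d L ∈ chainSpan τ a d (M + if b then 1 else 0)
  by_cases hb : ∀ p ∈ L.head?, b ≠ p.1
  · have := aeval_mul_chainProd_mem (d := d) hτ (M := M + if b then 1 else 0) Polynomial.X hL hb
      (by rw [Polynomial.natDegree_X]; omega)
    rwa [Polynomial.aeval_X] at this
  · rcases L with - | ⟨⟨b', f⟩, L⟩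
    · simp at hb
    · obtain rfl : b = b' := by simpa using hb
      have hL' : IsCentredChain τ a L := ⟨(List.isChain_cons.1 hL.alternating).2,
        fun p hp => hL.centred p (List.mem_cons_of_mem _ hp)⟩
      rw [chainProd_cons, ← mul_assoc]
      have := aeval_mul_chainProd_mem (d := d) hτ (M := M + if b then 1 else 0)
        (Polynomial.X * f) hL' (List.isChain_cons.1 hL.alternating).1 ?_
      · rwa [map_mul, Polynomial.aeval_X] at this
      · rw [chainDegree, List.map_cons, List.sum_cons] at hM
        rw [chainDegree]
        have hd : (Polynomial.X * f).natDegree ≤ f.natDegree + 1 := by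
          refine Polynomial.natDegree_mul_le.trans ?_
          rw [Polynomial.natDegree_X, add_comm]
        cases b <;> simp at hM ⊢ <;> omega

end Span

/-- A centred alternating product of the canonical operators has mean zero in the vacuum state, that
is, these operators are free. -/
theorem chainProd_canonicalOp_vac {τ : A →ₗ[ℂ] ℂ} {a : Bool → A} {κ : Bool → ℕ → ℂ} {N M : ℕ}
    (ht : ∀ n ≤ M, τ (a true ^ n) = fockCoeff (κ true) N n 0)
    (hf : ∀ n, τ (a false ^ n) = fockCoeff (κ false) N n 0)
    {L : List (Bool × Polynomial ℂ)} (hL : IsCentredChain τ a L) (hM : chainDegree L ≤ M)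
    (hne : L ≠ []) {w : List Bool} (hw : ∀ p ∈ L.head?, w.head? ≠ some p.1) :
    chainProd (fun b => canonicalOp (κ b) N b) L vac w = 0 := by
  induction L generalizing w with
  | nil => exact absurd rfl hne
  | cons p L ih =>
    obtain ⟨b, f⟩ := p
    have hL' : IsCentredChain τ a L := ⟨(List.isChain_cons.1 hL.alternating).2,
      fun p hp => hL.centred p (List.mem_cons_of_mem _ hp)⟩
    rw [chainDegree, List.map_cons, List.sum_cons, ← chainDegree] at hM
    -- The remaining product yields a vector supported on words that do not begin with `b`.
    have hF : ∀ w, chainProd (fun b => canonicalOp (κ b) N b) L vac (b :: w) = 0 := by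
      intro w
      rcases L with - | ⟨q, L⟩
      · simp [chainProd, vac]
      · refine ih hL' (by omega) (by simp) fun p hp => ?_
        have := (List.isChain_cons.1 hL.alternating).1 p hp
        simpa using this
    rw [chainProd_cons, Module.End.mul_apply, aeval_canonicalOp_apply _ _ hF (hw _ rfl)]
    have h0 : (f.sum fun n c => c * fockCoeff (κ b) N n 0) = τ (Polynomial.aeval (a b) f) := by
      rw [Polynomial.aeval_eq_sum_range, Polynomial.sum_over_range _ (by simp), map_sum]
      refine sum_congr rfl fun n hn => ?_
      rw [map_smul, smul_eq_mul]
      cases b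
      · rw [hf]
      · rw [ht]
        have := mem_range.1 hn
        simp only [if_true] at hM
        omega
    rw [h0, hL.centred _ List.mem_cons_self, map_zero, zero_mul]

/-- The joint moments, of degree at most `M` in `x`, of free elements `x` and `s` are those of the
canonical operators. -/
theorem map_fst_eq_of_mem_chainSpan {τ : A →ₗ[ℂ] ℂ} (hτ : τ 1 = 1) {x s : A} (h : AreFree τ x s)
    {κ : Bool → ℕ → ℂ} {N M : ℕ} (ht : ∀ n ≤ M, τ (x ^ n) = fockCoeff (κ true) N n 0)
    (hf : ∀ n, τ (s ^ n) = fockCoeff (κ false) N n 0)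
    {u : A × Module.End ℂ⟦X⟧ Fock}
    (hu : u ∈ chainSpan τ (fun b => if b then x else s)
      (fun b => (if b then x else s, canonicalOp (κ b) N b)) M) :
    C (τ u.1) = u.2 vac [] := by
  induction hu using Submodule.span_induction with
  | mem u hu =>
    obtain ⟨L, hL, hM, rfl⟩ := hu
    rw [chainProd_prod]
    by_cases hne : L = []
    · subst hne
      simp [chainProd, hτ, vac]
    · rw [map_chainProd_eq_zero h hL hne, map_zero]
      exact (chainProd_canonicalOp_vac (a := fun b => if b then x else s) (by simpa using ht)
        (by simpa using hf) hL hM hne (by simp)).symm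
  | zero => simp
  | add u v _ _ hu hv => simp [hu, hv]
  | smul c u _ hu => simp [← hu, PowerSeries.smul_eq_C_mul]

end Matching

/-! ### The resolvent of the commutator -/

/-- The pair of vectors `(ξ, η)` in the Fock space, given by their coefficients, where for
`c = compSeries κ` the vector `ξ` is the resolvent of `x + i [x, s]` applied to the vacuum, and
`s ξ = c η`. The recursion says what annihilation does to the two vectors: removing the letter `true`
maps `ξ` to `z (ξ + i c η)` and `η` to `-i z ξ`; removing the letter `false` maps `η` to `ξ`, and `ξ` to
`(c - 1) η`, up to a correction on the words that begin with `true` which makes `s ξ = c η` hold. -/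
noncomputable def resolventPair (c : ℂ⟦X⟧) : List Bool → ℂ⟦X⟧ × ℂ⟦X⟧
  | [] => (1, 0)
  | true :: w =>
    (X * ((resolventPair c w).1 + C Complex.I * c * (resolventPair c w).2),
      -(C Complex.I * X * (resolventPair c w).1))
  | false :: w =>
    ((c - 1) * (resolventPair c w).2 + if w.head? = some true then (resolventPair c w).2 else 0,
      (resolventPair c w).1)

/-- The first component of `resolventPair`. -/
noncomputable def resolventVec (c : ℂ⟦X⟧) : Fock := fun w => (resolventPair c w).1

/-- The second component of `resolventPair`. -/
noncomputable def resolventVec' (c : ℂ⟦X⟧) : Fock := fun w => (resolventPair c w).2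

section

variable (c : ℂ⟦X⟧)

theorem resolventVec_nil : resolventVec c [] = 1 := by simp [resolventVec, resolventPair]

theorem resolventVec'_nil : resolventVec' c [] = 0 := by simp [resolventVec', resolventPair]

theorem resolventVec_true (w : List Bool) : resolventVec c (true :: w) =
    X * (resolventVec c w + C Complex.I * c * resolventVec' c w) := by
  simp only [resolventVec, resolventVec', resolventPair]

theorem resolventVec'_true (w : List Bool) : resolventVec' c (true :: w) =
    -(C Complex.I * X * resolventVec c w) := by
  simp only [resolventVec, resolventVec', resolventPair]

theorem resolventVec_false (w : List Bool) : resolventVec c (false :: w) =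
    (c - 1) * resolventVec' c w + if w.head? = some true then resolventVec' c w else 0 := by
  simp only [resolventVec, resolventVec', resolventPair]

theorem resolventVec'_false (w : List Bool) :
    resolventVec' c (false :: w) = resolventVec c w := by
  simp only [resolventVec, resolventVec', resolventPair]

theorem C_I_mul_C_I : (C Complex.I * C Complex.I : ℂ⟦X⟧) = -1 := by
  rw [← map_mul, Complex.I_mul_I, map_neg, map_one]

/-- `ξ = Ω + (c - 1) r η + z ℓ (ξ + i c η) - i z r ℓ ξ`, for the creation operators `ℓ` of the letter
`true` and `r` of the letter `false`. -/
theorem resolventVec_eq (w : List Bool) : resolventVec c w = vac w +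
    (c - 1) * cre false (resolventVec' c) w +
    X * (cre true (resolventVec c) w + C Complex.I * c * cre true (resolventVec' c) w) -
    C Complex.I * X * cre false (cre true (resolventVec c)) w := by
  rcases w with - | ⟨b, w⟩
  · simp [resolventVec_nil, cre_nil, vac]
  cases b
  · rw [resolventVec_false]
    rcases w with - | ⟨b, w⟩
    · simp [resolventVec'_nil, cre_nil, cre_cons, vac]
    · cases b
      · simp [cre_cons, vac]
      · simp [cre_cons, vac, resolventVec'_true]
        ring
  · simp [resolventVec_true, cre_cons, vac]

variable {N : ℕ}

theorem semicircularOp_apply (hN : 2 ≤ N) (F : Fock) (w : List Bool) :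
    canonicalOp semicircularCumulant N false F w = cre false F w + F (false :: w) := by
  rw [canonicalOp_apply, sum_eq_single 1]
  · simp [semicircularCumulant]
  · intro i _ hi
    rw [semicircularCumulant, if_neg (by omega), map_zero, zero_mul]
  · intro h
    exact absurd (mem_range.2 hN) h

theorem semicircularOp_resolventVec (hN : 2 ≤ N) :
    canonicalOp semicircularCumulant N false (resolventVec c) = c • resolventVec' c := by
  ext1 w
  rw [semicircularOp_apply hN, resolventVec_false, Pi.smul_apply, smul_eq_mul]
  rcases w with - | ⟨b, w⟩
  · simp [resolventVec'_nil, cre_nil]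
  · cases b
    · simp [cre_cons, resolventVec'_false]
      ring
    · simp [cre_cons]
      ring

variable {κ : ℕ → ℂ}

/-- Iterated annihilation keeps the span of `ξ` and `η`; summing with the weights `κ (m + j)` produces
the series `weightSeries κ`. -/
theorem sum_mul_resolventVec (hκ : ∀ m, N < m → κ m = 0) (L m : ℕ) (hm : N < m + L)
    (w : List Bool) :
    ∑ j ∈ range L, C (κ (m + j)) * resolventVec (compSeries κ) (List.replicate j true ++ w) =
      weightSeries κ m * resolventVec (compSeries κ) w +
      C Complex.I * X * compSeries κ * weightSeries κ (m + 1) *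
        resolventVec' (compSeries κ) w := by
  induction L generalizing m w with
  | zero =>
    rw [weightSeries_eq_zero κ hκ (by omega), weightSeries_eq_zero κ hκ (by omega)]
    simp
  | succ L ih =>
    have h := ih (m + 1) (by omega) (true :: w)
    rw [sum_range_succ', List.replicate_zero, List.nil_append, add_zero]
    have e : ∀ j, List.replicate (j + 1) true ++ w = List.replicate j true ++ true :: w := by
      intro j
      rw [List.replicate_succ', List.append_assoc, List.singleton_append]
    simp_rw [e, ← add_assoc, add_right_comm m _ 1]
    rw [h, resolventVec_true, resolventVec'_true]
    have h1 := weightSeries_eq κ m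
    have h2 := tailSeries_eq_mul_weightSeries κ hκ m
    rw [h2] at h1
    linear_combination -resolventVec (compSeries κ) w * h1 -
      X ^ 2 * compSeries κ * weightSeries κ (m + 2) * resolventVec (compSeries κ) w * C_I_mul_C_I

theorem canonicalOp_resolventVec (hκ : ∀ m, N < m → κ m = 0) :
    canonicalOp κ N true (resolventVec (compSeries κ)) =
      cre true (resolventVec (compSeries κ)) + weightSeries κ 1 • resolventVec (compSeries κ) +
      (C Complex.I * X * compSeries κ * weightSeries κ 2) • resolventVec' (compSeries κ) := by
  ext1 w
  have h := sum_mul_resolventVec hκ N 1 (by omega) w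
  simp_rw [add_comm 1] at h
  rw [canonicalOp_apply, h]
  simp [add_assoc]

theorem canonicalOp_resolventVec' (hN : 2 ≤ N) (hκ : ∀ m, N < m → κ m = 0) (w : List Bool) :
    canonicalOp κ N true (resolventVec' (compSeries κ)) w =
      cre true (resolventVec' (compSeries κ)) w + C (κ 1) * resolventVec' (compSeries κ) w -
      C Complex.I * X * (weightSeries κ 2 * resolventVec (compSeries κ) w +
        C Complex.I * X * compSeries κ * weightSeries κ 3 * resolventVec' (compSeries κ) w) := by
  obtain ⟨L, rfl⟩ : ∃ L, N = L + 1 := ⟨N - 1, by omega⟩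
  have h := sum_mul_resolventVec hκ L 2 (by omega) w
  rw [canonicalOp_apply, sum_range_succ', ← h, mul_sum]
  have e : ∀ j, C (κ (j + 1 + 1)) *
      resolventVec' (compSeries κ) (List.replicate (j + 1) true ++ w) =
      -(C Complex.I * X * (C (κ (2 + j)) *
        resolventVec (compSeries κ) (List.replicate j true ++ w))) := by
    intro j
    rw [List.replicate_succ, List.cons_append, resolventVec'_true, add_comm 2 j]
    ring
  simp_rw [e, sum_neg_distrib]
  simp
  ring

/-- The resolvent equation `(a - z y) ξ = Ω` of `y = x + i [x, s]`, for `a = rhsSeries κ`. As the vacuum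
coefficient of `ξ` is `1`, it identifies `a` as `1` plus the generating function of the free cumulants
of `y`. -/
theorem resolvent_equation (hN : 2 ≤ N) (hκ : ∀ m, N < m → κ m = 0) :
    rhsSeries κ • resolventVec (compSeries κ) - (X : ℂ⟦X⟧) • (canonicalOp κ N true + Complex.I •
      (canonicalOp κ N true * canonicalOp semicircularCumulant N false -
        canonicalOp semicircularCumulant N false * canonicalOp κ N true))
      (resolventVec (compSeries κ)) = vac := by
  ext1 w
  have h0 := resolventVec_eq (compSeries κ) w
  have h1 := canonicalOp_resolventVec' hN hκ w
  have h2 : weightSeries κ 1 = C (κ 1) + X ^ 2 * compSeries κ * weightSeries κ 3 +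
      X * weightSeries κ 2 := by
    have := weightSeries_eq κ 1
    rwa [tailSeries_eq_mul_weightSeries κ hκ 1] at this
  have h3 := compSeries_eq κ
  have h4 : tailSeries κ 0 = X ^ 2 * compSeries κ * weightSeries κ 2 :=
    tailSeries_eq_mul_weightSeries κ hκ 0
  have hS : canonicalOp semicircularCumulant N false (resolventVec' (compSeries κ)) w =
      cre false (resolventVec' (compSeries κ)) w + resolventVec (compSeries κ) w := by
    rw [semicircularOp_apply hN, resolventVec'_false]
  have hT : canonicalOp semicircularCumulant N false (cre true (resolventVec (compSeries κ))) w =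
      cre false (cre true (resolventVec (compSeries κ))) w := by
    rw [semicircularOp_apply hN, cre_cons]
    simp
  simp only [LinearMap.add_apply, LinearMap.smul_apply, LinearMap.sub_apply,
    Module.End.mul_apply, semicircularOp_resolventVec _ hN, canonicalOp_resolventVec hκ, map_add,
    map_smul, Pi.add_apply, Pi.sub_apply, Pi.smul_apply, smul_eq_mul, PowerSeries.smul_eq_C_mul,
    hS, hT, h1, rhsSeries]
  set ξ := resolventVec (compSeries κ) w
  set η := resolventVec' (compSeries κ) w
  set r := cre false (resolventVec' (compSeries κ)) w
  set W := X ^ 2 * compSeries κ * weightSeries κ 2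
  -- In terms of `ξ`, `η` and their images under creation operators, all coefficients cancel by the
  -- relations between the series and `i ^ 2 = -1`.
  linear_combination h0 + (2 * ξ + r) * h4 + r * h3 +
    η * C Complex.I * X * compSeries κ * h2 +
    (2 * W * ξ + W * r + η * C Complex.I * X * compSeries κ *
      (X ^ 2 * compSeries κ * weightSeries κ 3)) * C_I_mul_C_I

end

/-! ### Comparison of the resolvent equations -/

/-- If `(a - z T) ξ = Ω` and the vacuum coefficient of `ξ` is `1`, then `1 = ∑ m_n z ^ n / a ^ (n + 1)`
for the vacuum moments `m_n` of `T`, up to terms of high order. -/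
theorem exists_one_eq_sum_moments {T : Module.End ℂ⟦X⟧ Fock} {ξ : Fock} {a u : ℂ⟦X⟧}
    (hau : a * u = 1) (h : a • ξ - (X : ℂ⟦X⟧) • T ξ = vac) (h1 : ξ [] = 1) (L : ℕ) :
    ∃ r, 1 = ∑ n ∈ range L, u ^ (n + 1) * X ^ n * (T ^ n) vac [] + X ^ L * r := by
  have hξ : ξ = u • vac + (u * X) • T ξ := by
    rw [← h, smul_sub, smul_smul, smul_smul, mul_comm u a, hau, one_smul, sub_add_cancel]
  have key : ξ = ∑ n ∈ range L, (u ^ (n + 1) * X ^ n) • (T ^ n) vac +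
      (u ^ L * X ^ L) • (T ^ L) ξ := by
    induction L with
    | zero => simp
    | succ L ih =>
      have hL : (T ^ L) ξ = u • (T ^ L) vac + (u * X) • (T ^ (L + 1)) ξ := by
        conv_lhs => rw [hξ]
        rw [map_add, map_smul, map_smul, pow_succ, Module.End.mul_apply]
      rw [sum_range_succ, add_assoc]
      conv_lhs => rw [ih, hL]
      rw [smul_add, smul_smul, smul_smul]
      congr 3 <;> ring
  refine ⟨u ^ L * (T ^ L) ξ [], ?_⟩
  rw [← h1]
  conv_lhs => rw [key]
  simp only [Pi.add_apply, Finset.sum_apply, Pi.smul_apply, smul_eq_mul]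
  ring

/-- A series `a` with `1 = ∑ m_n z ^ n / a ^ (n + 1)` is determined by the moments `m_n`. -/
theorem X_pow_dvd_sub_of_moments {a a' u u' r r' : ℂ⟦X⟧} (ha : a * u = 1) (ha' : a' * u' = 1)
    {N : ℕ} {m : ℕ → ℂ⟦X⟧} (hm : m 0 = 1)
    (h : 1 = ∑ n ∈ range (N + 1), u ^ (n + 1) * X ^ n * m n + X ^ (N + 1) * r)
    (h' : 1 = ∑ n ∈ range (N + 1), u' ^ (n + 1) * X ^ n * m n + X ^ (N + 1) * r') :
    X ^ (N + 1) ∣ a - a' := by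
  have hk : ∀ n : ℕ, ∃ k, u ^ (n + 1) - u' ^ (n + 1) = (u - u') * k := fun n =>
    sub_dvd_pow_sub_pow u u' (n + 1)
  choose k hk using hk
  have key : (u - u') * (1 + X * ∑ n ∈ range N, k (n + 1) * X ^ n * m (n + 1)) =
      X ^ (N + 1) * (r' - r) := by
    rw [sum_range_succ'] at h h'
    have h3 : (u - u') * (X * ∑ n ∈ range N, k (n + 1) * X ^ n * m (n + 1)) =
        ∑ n ∈ range N, u ^ (n + 1 + 1) * X ^ (n + 1) * m (n + 1) -
        ∑ n ∈ range N, u' ^ (n + 1 + 1) * X ^ (n + 1) * m (n + 1) := by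
      rw [mul_sum, mul_sum, ← sum_sub_distrib]
      refine sum_congr rfl fun n _ => ?_
      linear_combination -X ^ (n + 1) * m (n + 1) * hk (n + 1)
    rw [hm] at h h'
    linear_combination h3 - h + h'
  have hunit : IsUnit (1 + X * ∑ n ∈ range N, k (n + 1) * X ^ n * m (n + 1)) := by
    rw [PowerSeries.isUnit_iff_constantCoeff]
    simp
  have hdvd : X ^ (N + 1) ∣ u - u' :=
    hunit.dvd_mul_right.1 ⟨_, key⟩
  obtain ⟨q, hq⟩ := hdvd
  refine ⟨-(a * a' * q), ?_⟩
  linear_combination -a * a' * hq - a * ha' + a' * ha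

/-- The vector `∑ z ^ n ℓ ^ n Ω`, for the creation operator `ℓ` of the letter `true`. -/
noncomputable def geomVec : Fock := fun w => if ∀ b ∈ w, b = true then X ^ w.length else 0

theorem geomVec_replicate_append (j : ℕ) (w : List Bool) :
    geomVec (List.replicate j true ++ w) = X ^ j * geomVec w := by
  have : (∀ b ∈ List.replicate j true ++ w, b = true) ↔ ∀ b ∈ w, b = true := by
    simp only [List.mem_append, List.mem_replicate]
    exact ⟨fun h b hb => h b (Or.inr hb), fun h b hb => hb.elim (fun h => h.2) (h b)⟩
  simp only [geomVec, this]
  split_ifs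
  · rw [List.length_append, List.length_replicate, pow_add]
  · rw [mul_zero]

theorem geomVec_eq (w : List Bool) : geomVec w = vac w + X * cre true geomVec w := by
  rcases w with - | ⟨b, w⟩
  · simp [geomVec, vac, cre_nil]
  · cases b
    · simp [geomVec, vac, cre_cons]
    · have := geomVec_replicate_append 1 w
      simp only [List.replicate_one, List.singleton_append, pow_one] at this
      simp [this, vac, cre_cons]

/-- The resolvent equation of a canonical operator, whose solution is the geometric series of the
creation operator applied to the vacuum. -/
theorem canonicalOp_resolvent_equation (κ : ℕ → ℂ) (N : ℕ) :
    (1 + ∑ j ∈ range N, C (κ (j + 1)) * X ^ (j + 1)) • geomVec -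
      (X : ℂ⟦X⟧) • canonicalOp κ N true geomVec = vac := by
  ext1 w
  have h := geomVec_eq w
  have hs : X * ∑ j ∈ range N, C (κ (j + 1)) * geomVec (List.replicate j true ++ w) =
      (∑ j ∈ range N, C (κ (j + 1)) * X ^ (j + 1)) * geomVec w := by
    rw [mul_sum, sum_mul]
    refine sum_congr rfl fun j _ => ?_
    rw [geomVec_replicate_append]
    ring
  simp only [Pi.sub_apply, Pi.smul_apply, smul_eq_mul, canonicalOp_apply]
  linear_combination h - hs

theorem canonicalOp_pow_vac (κ : ℕ → ℂ) (N n : ℕ) :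
    (canonicalOp κ N true ^ n) vac [] = C (fockCoeff κ N n 0) := by
  have := canonicalOp_pow_apply κ N (b := true) (F := vac) (by simp [vac]) (w := []) (by simp) n 0
  simpa [vac] using this

/-- The sequence `κ` cut off after the index `M`. -/
noncomputable def truncate (κ : ℕ → ℂ) (M m : ℕ) : ℂ := if m ≤ M then κ m else 0

theorem truncate_eq_zero (κ : ℕ → ℂ) {M m : ℕ} (h : M < m) : truncate κ M m = 0 :=
  if_neg (not_le.2 h)

theorem ncListSum_truncate (κ : ℕ → ℂ) {M : ℕ} {l : List ℕ} (hl : l.sum ≤ M) :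
    ncListSum (truncate κ M) l = ncListSum κ l :=
  ncListSum_congr l fun m hm => by rw [truncate, if_pos (hm.trans hl)]

section Main

variable {A : Type*} [CStarAlgebra A] {τ : A →ₗ[ℂ] ℂ}

theorem map_pow_eq_fockCoeff (hτ : IsFaithfulTracialState τ) (a : A) {M N n : ℕ} (hM : M ≤ N)
    (hn : n ≤ M) : τ (a ^ n) = fockCoeff (truncate (fun m => kappa τ m a) M) N n 0 := by
  rw [fockCoeff_eq_ncListSum _ _ (fun m hm => truncate_eq_zero _ (by omega)),
    ncListSum_truncate _ (by simpa using hn), map_pow_eq_ncListSum hτ]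

theorem IsSemicircular.map_pow {s : A} (hs : IsSemicircular τ s) {N : ℕ} (hN : 2 ≤ N) (n : ℕ) :
    τ (s ^ n) = fockCoeff semicircularCumulant N n 0 := by
  rcases Nat.even_or_odd' n with ⟨m, rfl | rfl⟩
  · rw [hs.even_moment, (fockCoeff_semicircular hN m).1]
  · rw [hs.odd_moment, (fockCoeff_semicircular hN m).2]

theorem commutator_pow_mem_chainSpan (hτ : τ 1 = 1) {a : Bool → A} {B : Type*} [Ring B]
    [Algebra ℂ B] (d : Bool → B) (n : ℕ) :
    (d true + Complex.I • (d true * d false - d false * d true)) ^ n ∈ chainSpan τ a d n := by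
  induction n with
  | zero => simpa using one_mem_chainSpan 0
  | succ n ih =>
    rw [pow_succ', add_mul, smul_mul_assoc, sub_mul, mul_assoc, mul_assoc]
    have h1 := mul_mem_chainSpan (d := d) hτ true ih
    have h2 := mul_mem_chainSpan (d := d) hτ false ih
    have h3 := mul_mem_chainSpan (d := d) hτ true h2
    have h4 := mul_mem_chainSpan (d := d) hτ false h1
    exact Submodule.add_mem _ h1 (Submodule.smul_mem _ _ (Submodule.sub_mem _ h3 h4))

/-- The moments of `x + i [x, s]` of order at most `M` are those of its Fock space model. -/
theorem commutator_moment (hτ : IsFaithfulTracialState τ) {x s : A} (hs : IsSemicircular τ s)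
    (hfree : AreFree τ x s) {M N n : ℕ} (hM : M ≤ N) (hN : 2 ≤ N) (hn : n ≤ M) :
    C (τ ((x + Complex.I • (x * s - s * x)) ^ n)) =
      ((canonicalOp (truncate (fun m => kappa τ m x) M) N true + Complex.I •
        (canonicalOp (truncate (fun m => kappa τ m x) M) N true *
          canonicalOp semicircularCumulant N false -
        canonicalOp semicircularCumulant N false *
          canonicalOp (truncate (fun m => kappa τ m x) M) N true)) ^ n) vac [] := by
  have h := commutator_pow_mem_chainSpan hτ.map_one (a := fun b => if b then x else s)
    (fun b => ((if b then x else s : A), canonicalOp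
      (if b then truncate (fun m => kappa τ m x) M else semicircularCumulant) N b)) n
  have := map_fst_eq_of_mem_chainSpan hτ.map_one hfree
    (κ := fun b => if b then truncate (fun m => kappa τ m x) M else semicircularCumulant)
    (fun k hk => map_pow_eq_fockCoeff hτ x hM hk) (fun k => hs.map_pow hN k)
    (chainSpan_mono hn h)
  rw [Prod.pow_fst, Prod.pow_snd] at this
  exact this

/-- The free cumulants of `x + i [x, s]`, as a sum over compositions. Its moments have two models, by
the same polynomial in canonical operators and by a single canonical operator; comparing the two
resolvent equations modulo `z ^ (n + 1)` identifies the cumulants. -/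
theorem kappa_add_commutator (hτ : IsFaithfulTracialState τ) {x s : A} (hs : IsSemicircular τ s)
    (hfree : AreFree τ x s) {n : ℕ} (hn : n ≠ 0) :
    kappa τ n (x + Complex.I • (x * s - s * x)) = kappa τ n x +
      ∑ l ∈ compGeTwo n, (l.headI : ℂ) * ncListSum (fun m => kappa τ m x) l := by
  set y := x + Complex.I • (x * s - s * x) with hy
  -- Only cumulants of order at most `n` matter; the others are replaced by zero, so that the canonical
  -- operators involve finite sums. Any `N ≥ max n 2` would do.
  set κ := truncate (fun m => kappa τ m x) n with hκ
  set κ' := truncate (fun m => kappa τ m y) n with hκ'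
  set N := n + 2 with hN
  have h0 : ∀ m, N < m → κ m = 0 := fun m hm => truncate_eq_zero _ (by omega)
  set a : ℂ⟦X⟧ := 1 + ∑ j ∈ range N, C (κ' (j + 1)) * X ^ (j + 1) with ha
  obtain ⟨u, hu⟩ : ∃ u, rhsSeries κ * u = 1 := by
    refine (PowerSeries.isUnit_iff_constantCoeff.2 ?_).exists_right_inv
    simp [rhsSeries, tailSeries]
  obtain ⟨u', hu'⟩ : ∃ u', a * u' = 1 := by
    refine (PowerSeries.isUnit_iff_constantCoeff.2 ?_).exists_right_inv
    simp [ha]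
  obtain ⟨r, hr⟩ := exists_one_eq_sum_moments hu
    (resolvent_equation (by omega : 2 ≤ N) h0) (resolventVec_nil _) (n + 1)
  obtain ⟨r', hr'⟩ := exists_one_eq_sum_moments hu'
    (canonicalOp_resolvent_equation κ' N) (by simp [geomVec]) (n + 1)
  have hdvd : X ^ (n + 1) ∣ rhsSeries κ - a := by
    refine X_pow_dvd_sub_of_moments hu hu' (m := fun k => C (τ (y ^ k))) (r := r) (r' := r')
      (by simp [hτ.map_one]) (hr.trans ?_) (hr'.trans ?_)
    · congr 1
      refine sum_congr rfl fun k hk => ?_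
      rw [hy, commutator_moment hτ hs hfree (by omega : n ≤ N) (by omega)
        (Nat.lt_succ_iff.1 (mem_range.1 hk))]
    · congr 1
      refine sum_congr rfl fun k hk => ?_
      rw [canonicalOp_pow_vac, map_pow_eq_fockCoeff hτ y (by omega : n ≤ N)
        (Nat.lt_succ_iff.1 (mem_range.1 hk))]
  have hcoeff := (X_pow_dvd_iff.1 hdvd) n (Nat.lt_succ_self n)
  have hcoeff_a : coeff n a = kappa τ n y := by
    obtain ⟨m, rfl⟩ := Nat.exists_eq_succ_of_ne_zero hn
    rw [ha, map_add, coeff_one, if_neg hn, zero_add, map_sum, sum_eq_single m]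
    · simp [hκ', truncate]
    · intro j _ hj
      rw [coeff_C_mul, coeff_X_pow, if_neg (by omega), mul_zero]
    · intro h
      exact absurd (mem_range.2 (by omega)) h
  rw [map_sub, hcoeff_a, coeff_rhsSeries κ hn, sub_eq_zero] at hcoeff
  rw [← hcoeff, hκ, truncate, if_pos le_rfl]
  congr 1
  refine sum_congr rfl fun l hl => ?_
  rw [ncListSum_truncate _ (mem_compGeTwo.1 hl).1.le]

end Main

end FreeProb

theorem proposition1p2 {A : Type*} [CStarAlgebra A] (τ : A →ₗ[ℂ] ℂ)
    (hτ : FreeProb.IsFaithfulTracialState τ) (x s : A)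
    (hs : FreeProb.IsSemicircular τ s) (hfree : FreeProb.AreFree τ x s)
    (n : ℕ) (hn : 1 ≤ n) :
    FreeProb.kappa τ n (x + Complex.I • (x * s - s * x)) =
      FreeProb.kappa τ n x +
        ∑ k ∈ Finset.Icc 1 (n / 2),
          ∑ σ ∈ (FreeProb.IntGeTwo n).filter (fun σ => σ.parts.card = k),
            ∑ π ∈ FreeProb.NC σ.parts.card,
              ((σ.part ⟨0, hn⟩).card : ℂ) *
                FreeProb.kappaPartition τ (FreeProb.merge σ π) x := by
  rw [FreeProb.sum_IntGeTwo_eq]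
  exact FreeProb.kappa_add_commutator hτ hs hfree (Nat.one_le_iff_ne_zero.1 hn)
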